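/- Let $m\ge 1$ be an integer. The uniform attachment graph $G^m_n$ is the random loopless multigraph with vertex set $\{1,\dots,n\}$ in which every vertex $j\in\{2,\dots,n\}$ is born with $m$ edges labelled $1,\dots,m$, the other endpoint of each being chosen uniformly at random from $\{1,\dots,j-1\}$, all choices being independent (and the same for all $n$, so that $G^m_1\subseteq G^m_2\subseteq\cdots$); $G^m_\infty:=\bigcup_n G^m_n$. All graphs are loopless multigraphs. A copy of a graph $F$ in a graph $G$ is a subgraph of $G$ isomorphic to $F$. Let $H$ be a finite connected graph that is multicyclic, i.e. contains at least two (not necessarily edge- or vertex-disjoint) cycles, where a pair of parallel edges counts as a cycle of length 2. Let $H'$ be the 2-core of $H$, i.e. the largest subgraph of $H$ with all degrees at least $2$, and suppose that $H$ has exactly one vertex that is not in $H'$; in other words, $H$ is obtained from $H'$ by attaching a single edge ($t=1$). Let $W_n$ and $W'_n$ be the numbers of copies of $H$ and $H'$, respectively, in $G^m_n$, and let $W'_\infty$ be the number of copies of $H'$ in $G^m_\infty$. Let $r$ be the number of vertices $v$ of $H'$ such that attaching to $H'$ an edge at $v$ (leading to a new vertex) yields a graph isomorphic to $H$, and let $c:=rm$.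 Then $c>0$, $W'_\infty<\infty$ almost surely, and, as $n\to\infty$, $$\frac{W_n}{\log n}-c\,W'_n\to 0\quad\text{almost surely, and thus}\quad \frac{W_n}{\log n}\to c\,W'_\infty\quad\text{almost surely.}$$ -/

import Mathlib

open MeasureTheory ProbabilityTheory Filter Topology
open scoped Graph ENNReal

/-!
Graphs are loopless multigraphs: Mathlib's `Graph α β` (vertices in `α`, edges in `β`), with
`K ≤ G` meaning that `K` is a subgraph of `G`.
-/

namespace Graph

variable {α β α' β' : Type*}

/-- Two multigraphs are isomorphic: there are bijections between their vertices and between their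
edges that preserve incidence. -/
def IsIso (G : Graph α β) (H : Graph α' β') : Prop :=
  ∃ (φ : V(G) ≃ V(H)) (ψ : E(G) ≃ E(H)), ∀ (e : E(G)) (x y : V(G)),
    G.IsLink e x y ↔ H.IsLink (ψ e) (φ x) (φ y)

/-- The set of copies of `H` in `G`: the subgraphs of `G` that are isomorphic to `H`. -/
def copies (H : Graph α β) (G : Graph α' β') : Set (Graph α' β') :=
  {K | K ≤ G ∧ IsIso K H}

/-- `G` is connected: it is non-empty and any two vertices are joined by a walk. -/
def IsConnected (G : Graph α β) : Prop :=
  V(G).Nonempty ∧ ∀ x ∈ V(G), ∀ y ∈ V(G), Relation.ReflTransGen G.Adj x y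

/-- The cycle with `ℓ` vertices and `ℓ` edges (for `ℓ ≥ 1`): the edge `e` joins the vertices
`e` and `e + 1`. For `ℓ = 2` it is a pair of parallel edges. -/
def cycle (ℓ : ℕ) : Graph (ZMod ℓ) (ZMod ℓ) where
  vertexSet := Set.univ
  edgeSet := Set.univ
  IsLink e x y := s(x, y) = s(e, e + 1)
  isLink_symm := fun _ _ ↦ ⟨fun _ _ h ↦ Sym2.eq_swap.trans h⟩
  eq_or_eq_of_isLink_of_isLink := by
    intro e x y v w h h'
    have h2 := h.trans h'.symm
    rw [Sym2.eq_iff] at h2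
    tauto
  edge_mem_iff_exists_isLink := fun e ↦ ⟨fun _ ↦ ⟨e, e + 1, rfl⟩, fun _ ↦ Set.mem_univ e⟩
  left_mem_of_isLink := fun _ _ _ _ ↦ Set.mem_univ _

/-- The set of cycles (of all lengths `ℓ ≥ 2`) contained in `G`. -/
def cycles (G : Graph α β) : Set (Graph α β) :=
  {C | ∃ ℓ : ℕ, 2 ≤ ℓ ∧ C ∈ copies (cycle ℓ) G}

/-- `G` is multicyclic: it contains at least two (not necessarily disjoint) cycles. -/
def IsMulticyclic (G : Graph α β) : Prop :=
  2 ≤ G.cycles.encard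

/-- The degree of the vertex `x` in a loopless multigraph: the number of edges incident to it. -/
noncomputable def deg (G : Graph α β) (x : α) : ℕ∞ :=
  (G.incidenceSet x).encard

/-- `H'` is the 2-core of `H`: the largest subgraph of `H` in which all degrees are at least 2. -/
def IsTwoCore (H' H : Graph α β) : Prop :=
  IsGreatest {K : Graph α β | K ≤ H ∧ ∀ x ∈ V(K), 2 ≤ K.deg x} H'

/-- The graph obtained from `G` by adding one new vertex (`none`) and one new edge (`none`), which
joins the new vertex to the vertex `v` of `G`. -/
def attachEdge (G : Graph α β) (v : V(G)) : Graph (Option α) (Option β) where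
  vertexSet := insert none (some '' V(G))
  IsLink e x y :=
    (e = none ∧ s(x, y) = s(none, some (v : α))) ∨
      ∃ e' x' y', e = some e' ∧ x = some x' ∧ y = some y' ∧ G.IsLink e' x' y'
  isLink_symm := by
    rintro e -
    refine ⟨?_⟩
    rintro x y (⟨he, h⟩ | ⟨e', x', y', he, hx, hy, h⟩)
    · exact Or.inl ⟨he, Sym2.eq_swap.trans h⟩
    · exact Or.inr ⟨e', y', x', he, hy, hx, h.symm⟩
  eq_or_eq_of_isLink_of_isLink := by
    rintro e x y p q (⟨he, h⟩ | ⟨e', x', y', he, rfl, rfl, h⟩)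
      (⟨he2, h2⟩ | ⟨e2, x2, y2, he2, rfl, rfl, h2⟩)
    · have h3 := h.trans h2.symm
      rw [Sym2.eq_iff] at h3
      tauto
    · simp [he] at he2
    · simp [he2] at he
    · obtain rfl : e' = e2 := by simpa [he] using he2
      simpa using h.left_eq_or_eq h2
  left_mem_of_isLink := by
    rintro e x y (⟨-, h⟩ | ⟨e', x', y', -, rfl, -, h⟩)
    · rw [Sym2.eq_iff] at h
      rcases h with ⟨rfl, -⟩ | ⟨rfl, -⟩
      · exact Set.mem_insert _ _
      · exact Set.mem_insert_of_mem _ ⟨v, v.2, rfl⟩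
    · exact Set.mem_insert_of_mem _ ⟨x', h.left_mem, rfl⟩

/-- The number of vertices of `H'` such that attaching an edge at that vertex yields a copy
of `H`. -/
noncomputable def attachCount (H' : Graph α β) (H : Graph α' β') : ℕ :=
  {v : V(H') | IsIso (H'.attachEdge v) H}.ncard

end Graph

/-- `U j a` (`j ≥ 2`) is the random end vertex of the `a`th edge born with the vertex `j`: all these
choices are independent, and `U j a` is uniformly distributed on `{1, …, j - 1}`.
(The values `U j a` for `j < 2` play no role.) -/
structure IsUniformAttachment {Ω : Type*} [MeasurableSpace Ω] {m : ℕ}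
    (U : ℕ → Fin m → Ω → ℕ) (μ : Measure Ω) : Prop where
  measurable : ∀ j, 2 ≤ j → ∀ a, Measurable (U j a)
  uniform : ∀ j, 2 ≤ j → ∀ a, ∀ i, 1 ≤ i → i < j →
    μ {ω | U j a ω = i} = 1 / ((j - 1 : ℕ) : ℝ≥0∞)
  indep : iIndepFun (fun p : {j : ℕ // 2 ≤ j} × Fin m ↦ U p.1 p.2) μ

/-- The attachment graph for the choices `f`: its vertices are the positive integers `i ≤ n`
(all positive integers if `n = ⊤`), and for each vertex `j ≥ 2` and each label `a` it
has an edge, named `(j, a)`, between `j` and `f j a`. (Here `1 ≤ f j a < j`; an edge for which this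
fails is left out.) -/
def attachmentGraph {m : ℕ} (f : ℕ → Fin m → ℕ) (n : ℕ∞) : Graph ℕ (ℕ × Fin m) where
  vertexSet := {i | 1 ≤ i ∧ (i : ℕ∞) ≤ n}
  IsLink e x y :=
    2 ≤ e.1 ∧ (e.1 : ℕ∞) ≤ n ∧ (1 ≤ f e.1 e.2 ∧ f e.1 e.2 < e.1) ∧ s(x, y) = s(e.1, f e.1 e.2)
  isLink_symm := fun _ _ ↦ ⟨fun _ _ h ↦ ⟨h.1, h.2.1, h.2.2.1, Sym2.eq_swap.trans h.2.2.2⟩⟩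
  eq_or_eq_of_isLink_of_isLink := by
    rintro e x y v w ⟨-, -, -, h⟩ ⟨-, -, -, h'⟩
    have h2 := h.trans h'.symm
    rw [Sym2.eq_iff] at h2
    tauto
  left_mem_of_isLink := by
    rintro e x y ⟨h1, h2, ⟨h3, h4⟩, h⟩
    rw [Sym2.eq_iff] at h
    rcases h with ⟨rfl, -⟩ | ⟨rfl, -⟩
    · exact ⟨by omega, h2⟩
    · exact ⟨h3, le_trans (by exact_mod_cast h4.le) h2⟩

/-- The number of copies of `H` in the random graph with `m` edges born at each vertex and vertices
`1, …, n` (`n = ⊤`: all positive integers), at the sample point `ω`. For `n = ⊤` it is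
meaningful only if there are finitely many copies. -/
noncomputable def copyCount {α β Ω : Type*} {m : ℕ} (H : Graph α β) (U : ℕ → Fin m → Ω → ℕ)
    (n : ℕ∞) (ω : Ω) : ℕ :=
  (Graph.copies H (attachmentGraph (fun j a ↦ U j a ω) n)).ncard

/-!
In a connected multicyclic graph with all degrees at least 2, every nonempty set `S` of vertices
meets more than `|S|` edges, hence at least `s |S|` of them for some fixed `s > 1`. For an injective
placement `φ` of the vertices of `H'`, the probability that all edges are present is at most a
constant times the product of `1 / max (φ x) (φ y)` over the edges `xy`. Applying the count of
edges to the sets `{v | t < φ v}` shows that this is at most a constant times `∏ v, (φ v) ^ (-s)`.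
This is summable over `φ`, so by Borel–Cantelli there are almost surely only finitely many copies
of `H'`.

A copy of `H` is its 2-core, which is a copy of `H'`, together with a pendant edge. The edges with a
given label whose earlier end is a given vertex appear independently with probabilities
`1 / (j - 1)`, so by a strong law of large numbers about `log n` of them are born by time `n`. Hence
every copy of `H'` is the 2-core of about `r m log n` copies of `H`.
-/

section Isomorphism

open Graph

variable {α β α' β' α'' β'' : Type*} {G : Graph α β} {H : Graph α' β'}

lemma isIso_symm (h : IsIso G H) : IsIso H G := by
  obtain ⟨φ, ψ, h⟩ := h
  exact ⟨φ.symm, ψ.symm, fun e x y ↦ by simp [h]⟩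

lemma isIso_trans {K : Graph α'' β''} (h : IsIso G H) (h' : IsIso H K) : IsIso G K := by
  obtain ⟨φ, ψ, h⟩ := h
  obtain ⟨φ', ψ', h'⟩ := h'
  exact ⟨φ.trans φ', ψ.trans ψ', fun e x y ↦ by simp [h, h']⟩

lemma isIso_of_isLink_imp (φ : V(G) ≃ V(H)) (ψ : E(G) ≃ E(H))
    (h : ∀ (e : E(G)) (x y : V(G)), G.IsLink e x y → H.IsLink (ψ e) (φ x) (φ y)) :
    IsIso G H := by
  refine ⟨φ, ψ, fun e x y ↦ ⟨h e x y, fun hxy ↦ ?_⟩⟩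
  obtain ⟨a, b, hab⟩ := exists_isLink_of_mem_edgeSet e.2
  have hab' := h e ⟨a, hab.left_mem⟩ ⟨b, hab.right_mem⟩ hab
  rcases hab'.eq_and_eq_or_eq_and_eq hxy with ⟨hx, hy⟩ | ⟨hy, hx⟩ <;>
    rw [← φ.injective (Subtype.ext hx), ← φ.injective (Subtype.ext hy)]
  exacts [hab, hab.symm]

lemma isIso_of_le_of_le {G' : Graph α β} {H' : Graph α' β'} (hG : G' ≤ G) (hH : H' ≤ H)
    (φ : V(G) ≃ V(H)) (ψ : E(G) ≃ E(H))
    (h : ∀ (e : E(G)) (x y : V(G)), G.IsLink e x y ↔ H.IsLink (ψ e) (φ x) (φ y))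
    (hφ : ∀ x : V(G), (x : α) ∈ V(G') ↔ (φ x : α') ∈ V(H'))
    (hψ : ∀ e : E(G), (e : β) ∈ E(G') ↔ (ψ e : β') ∈ E(H')) : IsIso G' H' := by
  let φ' : V(G') ≃ V(H') := (Equiv.subtypeSubtypeEquivSubtype @hG.vertexSet_mono).symm.trans
    ((φ.subtypeEquiv hφ).trans (Equiv.subtypeSubtypeEquivSubtype @hH.vertexSet_mono))
  let ψ' : E(G') ≃ E(H') := (Equiv.subtypeSubtypeEquivSubtype @hG.edgeSet_mono).symm.trans
    ((ψ.subtypeEquiv hψ).trans (Equiv.subtypeSubtypeEquivSubtype @hH.edgeSet_mono))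
  refine isIso_of_isLink_imp φ' ψ' fun e x y hxy ↦ (hH.isLink_iff (ψ' e).2).2 ?_
  exact (h ⟨e, hG.edgeSet_mono e.2⟩ ⟨x, hG.vertexSet_mono x.2⟩ ⟨y, hG.vertexSet_mono y.2⟩).1
    (hxy.mono hG)

lemma exists_le_preimage {H' : Graph α' β'} (hH : H' ≤ H) (φ : V(G) ≃ V(H)) (ψ : E(G) ≃ E(H))
    (h : ∀ (e : E(G)) (x y : V(G)), G.IsLink e x y ↔ H.IsLink (ψ e) (φ x) (φ y)) :
    ∃ G' ≤ G, (∀ x : V(G), (x : α) ∈ V(G') ↔ (φ x : α') ∈ V(H')) ∧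
      ∀ e : E(G), (e : β) ∈ E(G') ↔ (ψ e : β') ∈ E(H') := by
  let S : Set α := {x | ∃ hx : x ∈ V(G), (φ ⟨x, hx⟩ : α') ∈ V(H')}
  let F : Set β := {e | ∃ he : e ∈ E(G), (ψ ⟨e, he⟩ : β') ∈ E(H')}
  refine ⟨(G.induce S).restrict F, restrict_le.trans (induce_le fun x hx ↦ hx.1),
    fun x ↦ ⟨fun hx ↦ hx.2, fun hx ↦ ⟨x.2, hx⟩⟩, fun e ↦ ⟨fun he ↦ he.2.2, fun he ↦ ?_⟩⟩
  obtain ⟨x, y, hxy⟩ := exists_isLink_of_mem_edgeSet e.2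
  have hxy' : H'.IsLink (ψ e) (φ ⟨x, hxy.left_mem⟩) (φ ⟨y, hxy.right_mem⟩) :=
    (hH.isLink_iff he).2 ((h e ⟨x, _⟩ ⟨y, _⟩).1 hxy)
  exact ⟨⟨x, y, hxy, ⟨hxy.left_mem, hxy'.left_mem⟩, ⟨hxy.right_mem, hxy'.right_mem⟩⟩, e.2, he⟩

lemma two_le_deg_iff {x : α} : 2 ≤ G.deg x ↔ ∃ e f, e ≠ f ∧ G.Inc e x ∧ G.Inc f x := by
  rw [← one_add_one_eq_two, ENat.add_one_le_iff (by simp), deg, Set.one_lt_encard_iff]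
  constructor
  · rintro ⟨e, f, he, hf, hef⟩
    exact ⟨e, f, hef, he, hf⟩
  · rintro ⟨e, f, hef, he, hf⟩
    exact ⟨e, f, he, hf, hef⟩

lemma two_le_deg_of_le {K : Graph α β} (h : K ≤ G) {x : α} (hx : 2 ≤ K.deg x) : 2 ≤ G.deg x := by
  rw [two_le_deg_iff] at hx ⊢
  obtain ⟨e, f, hef, he, hf⟩ := hx
  exact ⟨e, f, hef, he.mono h, hf.mono h⟩

lemma two_le_deg_of_isIso (h : IsIso G H) (hH : ∀ x ∈ V(H), 2 ≤ H.deg x) :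
    ∀ x ∈ V(G), 2 ≤ G.deg x := by
  obtain ⟨φ, ψ, h⟩ := h
  intro x hx
  have exists_inc : ∀ e, H.Inc e (φ ⟨x, hx⟩) → ∃ e' : E(G), ψ e' = e ∧ G.Inc e' x := by
    rintro e ⟨y, hy⟩
    refine ⟨ψ.symm ⟨e, hy.edge_mem⟩, by simp, φ.symm ⟨y, hy.right_mem⟩, ?_⟩
    exact (h (ψ.symm ⟨e, hy.edge_mem⟩) ⟨x, hx⟩ (φ.symm ⟨y, hy.right_mem⟩)).2 (by simpa using hy)
  obtain ⟨e, f, hef, he, hf⟩ := two_le_deg_iff.1 (hH _ (φ ⟨x, hx⟩).2)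
  obtain ⟨e', rfl, he'⟩ := exists_inc e he
  obtain ⟨f', rfl, hf'⟩ := exists_inc f hf
  exact two_le_deg_iff.2 ⟨e', f', fun heq ↦ hef (by rw [Subtype.ext heq]), he', hf'⟩

end Isomorphism

section AttachEdge

open Graph

variable {α β α' β' : Type*} {G : Graph α β} {H : Graph α' β'}

lemma none_mem_edgeSet_attachEdge (G : Graph α β) (v : V(G)) : none ∈ E(G.attachEdge v) :=
  ⟨none, some v, Or.inl ⟨rfl, rfl⟩⟩

/-- The vertices of `G.attachEdge v` are those of `G` and the new vertex `none`. -/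
def attachEdgeVertexEquiv (G : Graph α β) (v : V(G)) : V(G.attachEdge v) ≃ Option V(G) where
  toFun
    | ⟨none, _⟩ => none
    | ⟨some x, h⟩ => some ⟨x, by simpa [attachEdge] using h⟩
  invFun
    | none => ⟨none, by simp [attachEdge]⟩
    | some x => ⟨some x, by simp [attachEdge]⟩
  left_inv := by rintro ⟨_ | x, h⟩ <;> rfl
  right_inv := by rintro (_ | x) <;> rfl

lemma some_mem_edgeSet_attachEdge {v : V(G)} {e : β} :
    some e ∈ E(G.attachEdge v) ↔ e ∈ E(G) := by
  constructor
  · rintro ⟨x, y, ⟨he, -⟩ | ⟨_, _, _, he, -, -, hxy⟩⟩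
    · cases he
    · cases he
      exact hxy.edge_mem
  · intro he
    obtain ⟨x, y, hxy⟩ := exists_isLink_of_mem_edgeSet he
    exact ⟨some x, some y, Or.inr ⟨e, x, y, rfl, rfl, rfl, hxy⟩⟩

/-- The edges of `G.attachEdge v` are those of `G` and the new edge `none`. -/
def attachEdgeEdgeEquiv (G : Graph α β) (v : V(G)) : E(G.attachEdge v) ≃ Option E(G) where
  toFun
    | ⟨none, _⟩ => none
    | ⟨some x, h⟩ => some ⟨x, some_mem_edgeSet_attachEdge.1 h⟩
  invFun
    | none => ⟨none, none_mem_edgeSet_attachEdge G v⟩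
    | some x => ⟨some x, some_mem_edgeSet_attachEdge.2 x.2⟩
  left_inv := by rintro ⟨_ | x, h⟩ <;> rfl
  right_inv := by rintro (_ | x) <;> rfl

lemma attachEdge_isIso (v : V(G)) (φ : Option V(G) ≃ V(H)) (ψ : Option E(G) ≃ E(H))
    (hnew : H.IsLink (ψ none) (φ (some v)) (φ none))
    (hold : ∀ (e : E(G)) (x y : V(G)), G.IsLink e x y →
      H.IsLink (ψ (some e)) (φ (some x)) (φ (some y))) :
    IsIso (G.attachEdge v) H := by
  refine isIso_of_isLink_imp ((attachEdgeVertexEquiv G v).trans φ)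
    ((attachEdgeEdgeEquiv G v).trans ψ) ?_
  rintro ⟨_, _⟩ ⟨_, _⟩ ⟨_, _⟩ (⟨rfl, hxy⟩ | ⟨e, x, y, rfl, rfl, rfl, hxy⟩)
  · rcases Sym2.eq_iff.1 hxy with ⟨rfl, rfl⟩ | ⟨rfl, rfl⟩
    exacts [hnew.symm, hnew]
  · exact hold ⟨e, hxy.edge_mem⟩ ⟨x, hxy.left_mem⟩ ⟨y, hxy.right_mem⟩ hxy

lemma attachEdge_isIso_attachEdge (φ : V(G) ≃ V(H)) (ψ : E(G) ≃ E(H))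
    (h : ∀ (e : E(G)) (x y : V(G)), G.IsLink e x y ↔ H.IsLink (ψ e) (φ x) (φ y)) (v : V(G)) :
    IsIso (G.attachEdge v) (H.attachEdge (φ v)) :=
  attachEdge_isIso v ((Equiv.optionCongr φ).trans (attachEdgeVertexEquiv H (φ v)).symm)
    ((Equiv.optionCongr ψ).trans (attachEdgeEdgeEquiv H (φ v)).symm)
    (Or.inl ⟨rfl, Sym2.eq_swap⟩)
    fun e x y hxy ↦ Or.inr ⟨ψ e, φ x, φ y, rfl, rfl, rfl, (h e x y).1 hxy⟩

lemma attachCount_congr {α'' β'' : Type*} (h : IsIso G H) (K : Graph α'' β'') :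
    attachCount G K = attachCount H K := by
  obtain ⟨φ, ψ, h⟩ := h
  have isIso_iff (v : V(G)) : IsIso (G.attachEdge v) K ↔ IsIso (H.attachEdge (φ v)) K :=
    ⟨isIso_trans (isIso_symm (attachEdge_isIso_attachEdge φ ψ h v)),
      isIso_trans (attachEdge_isIso_attachEdge φ ψ h v)⟩
  exact Nat.card_congr (φ.subtypeEquiv isIso_iff)

end AttachEdge

section PendantExtension

open Graph

variable {α β α' β' : Type*} {K' K G : Graph α β} {e : β} {v w : α}

/-- `K` is the graph `K'` together with a pendant edge: it has one more vertex, `w`, and one more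
edge, `e`, which joins `w` to the vertex `v` of `K'`. -/
structure IsPendantExtension (K' K : Graph α β) (e : β) (v w : α) : Prop where
  le : K' ≤ K
  isLink : K.IsLink e v w
  left_mem : v ∈ V(K')
  right_notMem : w ∉ V(K')
  vertexSet_eq : V(K) = insert w V(K')
  edgeSet_eq : E(K) = insert e E(K')

open Classical in
/-- A set with one additional element `a`, as `Option`: `none` corresponds to `a`. -/
noncomputable def optionEquivOfEqInsert {s t : Set α} {a : α} (ha : a ∉ s) (ht : t = insert a s) :
    Option s ≃ t :=
  (Equiv.optionEquivSumPUnit s).trans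
    ((Equiv.Set.insert ha).symm.trans (Equiv.setCongr ht.symm))

lemma eq_insert_of_equiv {s : Set α} {t : Set α'} (φ : s ≃ t) {s' : Set α} {t' : Set α'}
    (hs : s' ⊆ s) (hφ : ∀ x : s, (x : α) ∈ s' ↔ (φ x : α') ∈ t') (y : t)
    (ht : t = insert (y : α') t') : s = insert (φ.symm y : α) s' := by
  refine (Set.insert_subset (φ.symm y).2 hs).antisymm' fun x hx ↦ ?_
  rcases ht.subset (φ ⟨x, hx⟩).2 with hxy | hxt
  · left
    simp [← Subtype.ext hxy]
  · exact Or.inr ((hφ ⟨x, hx⟩).2 hxt)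

namespace IsPendantExtension

lemma edge_notMem (h : IsPendantExtension K' K e v w) : e ∉ E(K') := fun he ↦
  h.right_notMem ((h.le.isLink_iff he).2 h.isLink).right_mem

lemma isIso_attachEdge (h : IsPendantExtension K' K e v w) :
    IsIso (K'.attachEdge ⟨v, h.left_mem⟩) K :=
  attachEdge_isIso _ (optionEquivOfEqInsert h.right_notMem h.vertexSet_eq)
    (optionEquivOfEqInsert h.edge_notMem h.edgeSet_eq) h.isLink fun _ _ _ hxy ↦ hxy.mono h.le

lemma attachCount_pos (h : IsPendantExtension K' K e v w) (hV : V(K').Finite) :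
    0 < attachCount K' K := by
  have := hV.to_subtype
  exact (Set.ncard_pos (Set.toFinite _)).2 ⟨⟨v, h.left_mem⟩, h.isIso_attachEdge⟩

lemma eq_of_inc_right (h : IsPendantExtension K' K e v w) {f : β} (hf : K.Inc f w) : f = e :=
  (h.edgeSet_eq.subset hf.edge_mem).resolve_right fun hfK' ↦
    h.right_notMem ((h.le.inc_congr hfK').2 hf).vertex_mem

lemma isTwoCore (h : IsPendantExtension K' K e v w) (hdeg : ∀ x ∈ V(K'), 2 ≤ K'.deg x) :
    IsTwoCore K' K := by
  refine ⟨⟨h.le, hdeg⟩, fun L ⟨hL, hLdeg⟩ ↦ ?_⟩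
  have hw : w ∉ V(L) := fun hw ↦ by
    obtain ⟨f, g, hfg, hf, hg⟩ := two_le_deg_iff.1 (hLdeg w hw)
    exact hfg ((h.eq_of_inc_right (hf.mono hL)).trans (h.eq_of_inc_right (hg.mono hL)).symm)
  constructor
  · intro x hx
    exact (h.vertexSet_eq.subset (hL.vertexSet_mono hx)).resolve_left fun hxw ↦ hw (hxw ▸ hx)
  · intro f x y hxy
    rcases h.edgeSet_eq.subset (hxy.mono hL).edge_mem with rfl | hf
    · exact absurd ((hL.isLink_iff hxy.edge_mem).2 h.isLink).right_mem hw
    · exact (h.le.isLink_iff hf).2 (hxy.mono hL)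

lemma exists_of_isIso {H' H : Graph α' β'} {e₀ : β'} {v₀ w₀ : α'}
    (h : IsPendantExtension H' H e₀ v₀ w₀) (hiso : IsIso K H) :
    ∃ K' e v w, IsPendantExtension K' K e v w ∧ IsIso K' H' := by
  obtain ⟨φ, ψ, hlink⟩ := hiso
  obtain ⟨K', hle, hV, hE⟩ := exists_le_preimage h.le φ ψ hlink
  let v : V(K) := φ.symm ⟨v₀, h.isLink.left_mem⟩
  let w : V(K) := φ.symm ⟨w₀, h.isLink.right_mem⟩
  let e : E(K) := ψ.symm ⟨e₀, h.isLink.edge_mem⟩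
  have hext : IsPendantExtension K' K e v w :=
    { le := hle
      isLink := (hlink e v w).2 (by simpa [e, v, w] using h.isLink)
      left_mem := (hV v).2 (by simpa [v] using h.left_mem)
      right_notMem := fun hw ↦ h.right_notMem (by simpa [w] using (hV w).1 hw)
      vertexSet_eq := eq_insert_of_equiv φ hle.vertexSet_mono hV _ h.vertexSet_eq
      edgeSet_eq := eq_insert_of_equiv ψ hle.edgeSet_mono hE _ h.edgeSet_eq }
  exact ⟨K', e, v, w, hext, isIso_of_le_of_le hle h.le φ ψ hlink hV hE⟩

end IsPendantExtension

/-- The subgraph of `G` obtained from its subgraph `K'` by adding the edge `e` and its ends. -/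
def addEdge (G K' : Graph α β) (e : β) : Graph α β :=
  (G.induce (V(K') ∪ {x | G.Inc e x})).restrict (insert e E(K'))

lemma addEdge_le (hK : K' ≤ G) : addEdge G K' e ≤ G :=
  restrict_le.trans (induce_le (Set.union_subset hK.vertexSet_mono fun _ hx ↦ hx.vertex_mem))

lemma isPendantExtension_addEdge (hK : K' ≤ G) (h : G.IsLink e v w) (hv : v ∈ V(K'))
    (hw : w ∉ V(K')) : IsPendantExtension K' (addEdge G K' e) e v w := by
  have isLink_old {f x y} (hxy : K'.IsLink f x y) : (addEdge G K' e).IsLink f x y :=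
    ⟨Or.inr hxy.edge_mem, hxy.mono hK, Or.inl hxy.left_mem, Or.inl hxy.right_mem⟩
  have isLink_new : (addEdge G K' e).IsLink e v w :=
    ⟨Or.inl rfl, h, Or.inr h.inc_left, Or.inr h.inc_right⟩
  refine ⟨⟨Set.subset_union_left, fun f x y ↦ isLink_old⟩, isLink_new, hv, hw, ?_, ?_⟩
  · refine Set.Subset.antisymm ?_ (Set.insert_subset isLink_new.right_mem Set.subset_union_left)
    refine Set.union_subset (Set.subset_insert w _) fun x hx ↦ ?_
    rcases hx.eq_or_eq_of_isLink h with rfl | rfl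
    exacts [Or.inr hv, Or.inl rfl]
  · refine Set.Subset.antisymm (fun f hf ↦ hf.2)
      (Set.insert_subset isLink_new.edge_mem fun f hf ↦ ?_)
    obtain ⟨x, y, hxy⟩ := exists_isLink_of_mem_edgeSet hf
    exact (isLink_old hxy).edge_mem

lemma IsPendantExtension.eq_addEdge (h : IsPendantExtension K' K e v w) (hK : K ≤ G) :
    K = addEdge G K' e := by
  have hK' := h.le.trans hK
  have hadd := isPendantExtension_addEdge hK' (h.isLink.mono hK) h.left_mem h.right_notMem
  exact (Compatible.of_le_le hK (addEdge_le hK')).ext (h.vertexSet_eq.trans hadd.vertexSet_eq.symm)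
    (h.edgeSet_eq.trans hadd.edgeSet_eq.symm)

/-- The edges of `G` that extend its subgraph `K'` to a copy of `H` by a pendant edge. -/
def extendingEdges (H : Graph α' β') (K' G : Graph α β) : Set β :=
  {e | ∃ v, ∃ hv : v ∈ V(K'), ∃ w, w ∉ V(K') ∧ G.IsLink e v w ∧ IsIso (K'.attachEdge ⟨v, hv⟩) H}

lemma addEdge_mem_copies {H : Graph α' β'} (hK : K' ≤ G) (he : e ∈ extendingEdges H K' G) :
    addEdge G K' e ∈ copies H G := by
  obtain ⟨v, hv, w, hw, hlink, hiso⟩ := he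
  exact ⟨addEdge_le hK,
    isIso_trans (isIso_symm (isPendantExtension_addEdge hK hlink hv hw).isIso_attachEdge) hiso⟩

lemma exists_addEdge_of_mem_copies {H' H : Graph α' β'} {e₀ : β'} {v₀ w₀ : α'}
    (h : IsPendantExtension H' H e₀ v₀ w₀) (hK : K ∈ copies H G) :
    ∃ K' ∈ copies H' G, ∃ e ∈ extendingEdges H K' G, K = addEdge G K' e := by
  obtain ⟨hle, hiso⟩ := hK
  obtain ⟨K', e, v, w, hext, hiso'⟩ := h.exists_of_isIso hiso
  exact ⟨K', ⟨hext.le.trans hle, hiso'⟩, e, ⟨v, hext.left_mem, w, hext.right_notMem,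
    hext.isLink.mono hle, isIso_trans hext.isIso_attachEdge hiso⟩, hext.eq_addEdge hle⟩

-- The copy of `H'` inside a copy of `H` is recovered as its 2-core.
lemma eq_and_eq_of_addEdge_eq {H : Graph α' β'} {L' : Graph α β} {f : β} (hK : K' ≤ G)
    (hL : L' ≤ G) (hKdeg : ∀ x ∈ V(K'), 2 ≤ K'.deg x) (hLdeg : ∀ x ∈ V(L'), 2 ≤ L'.deg x)
    (he : e ∈ extendingEdges H K' G) (hf : f ∈ extendingEdges H L' G)
    (heq : addEdge G K' e = addEdge G L' f) : K' = L' ∧ e = f := by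
  obtain ⟨v, hv, w, hw, hvw, -⟩ := he
  obtain ⟨x, hx, y, hy, hxy, -⟩ := hf
  have hextK := isPendantExtension_addEdge hK hvw hv hw
  have hextL := isPendantExtension_addEdge hL hxy hx hy
  rw [heq] at hextK
  obtain rfl : K' = L' := (hextK.isTwoCore hKdeg).unique (hextL.isTwoCore hLdeg)
  exact ⟨rfl, (hextL.edgeSet_eq.subset hextK.isLink.edge_mem).resolve_right hextK.edge_notMem⟩

lemma ncard_copies_eq_sum {H' H : Graph α' β'} {e₀ : β'} {v₀ w₀ : α'}
    (h : IsPendantExtension H' H e₀ v₀ w₀) (hdeg : ∀ x ∈ V(H'), 2 ≤ H'.deg x) (hE : E(G).Finite)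
    (hfin : (copies H' G).Finite) :
    (copies H G).ncard = ∑ K' ∈ hfin.toFinset, (extendingEdges H K' G).ncard := by
  have hfinE (K' : Graph α β) : (extendingEdges H K' G).Finite :=
    hE.subset fun e ⟨_, _, _, _, hlink, _⟩ ↦ hlink.edge_mem
  let s : Finset (Σ _ : Graph α β, β) := hfin.toFinset.sigma fun K' ↦ (hfinE K').toFinset
  have mem_s (p : Σ _ : Graph α β, β) : p ∈ (s : Set (Σ _ : Graph α β, β)) ↔
      p.1 ∈ copies H' G ∧ p.2 ∈ extendingEdges H p.1 G := by
    simp [s]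
  have himage : (fun p : (Σ _ : Graph α β, β) ↦ addEdge G p.1 p.2) '' s = copies H G := by
    ext K
    constructor
    · rintro ⟨p, hp, rfl⟩
      exact addEdge_mem_copies ((mem_s p).1 hp).1.1 ((mem_s p).1 hp).2
    · intro hK
      obtain ⟨K', hK', e, he, rfl⟩ := exists_addEdge_of_mem_copies h hK
      exact ⟨⟨K', e⟩, (mem_s _).2 ⟨hK', he⟩, rfl⟩
  have hinj : Set.InjOn (fun p : (Σ _ : Graph α β, β) ↦ addEdge G p.1 p.2) s := by
    rintro ⟨K', e⟩ hp ⟨L', f⟩ hq heq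
    obtain ⟨⟨hK, hKiso⟩, he⟩ := (mem_s _).1 hp
    obtain ⟨⟨hL, hLiso⟩, hf⟩ := (mem_s _).1 hq
    obtain ⟨rfl, rfl⟩ := eq_and_eq_of_addEdge_eq hK hL (two_le_deg_of_isIso hKiso hdeg)
      (two_le_deg_of_isIso hLiso hdeg) he hf heq
    rfl
  rw [← himage, hinj.ncard_image, Set.ncard_coe_finset, Finset.card_sigma]
  exact Finset.sum_congr rfl fun K' _ ↦ (Set.ncard_eq_toFinset_card _ _).symm

end PendantExtension

section TwoCore

open Graph

variable {α β : Type*} {G H H' K K' C : Graph α β}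

lemma eq_vertexSet_of_adj_closed (hG : G.IsConnected) {S : Set α} (hS : S ⊆ V(G))
    (hne : S.Nonempty) (hadj : ∀ x ∈ S, ∀ y, G.Adj x y → y ∈ S) : S = V(G) := by
  obtain ⟨x, hx⟩ := hne
  refine hS.antisymm fun y hy ↦ ?_
  induction hG.2 x (hS hx) y hy with
  | refl => exact hx
  | tail _ hyz ih => exact hadj _ (ih hyz.left_mem) _ hyz

lemma eq_of_isClosedSubgraph (hG : G.IsConnected) (hK : K ≤c G) (hne : V(K).Nonempty) :
    K = G :=
  hK.isInducedSubgraph.ext_of_vertexSet <| eq_vertexSet_of_adj_closed hG hK.le.vertexSet_mono hne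
    fun _ hx _ hxy ↦ (hK.mem_iff_of_adj hxy).1 hx

-- Contracting the pendant edge maps every walk in `K` to a walk in `K'`.
lemma IsPendantExtension.isConnected {e : β} {v w : α} (h : IsPendantExtension K' K e v w)
    (hK : K.IsConnected) : K'.IsConnected := by
  classical
  let ρ : α → α := Function.update id w v
  have ρ_right : ρ w = v := Function.update_self ..
  have ρ_of_mem {x : α} (hx : x ∈ V(K')) : ρ x = x :=
    Function.update_of_ne (ne_of_mem_of_not_mem hx h.right_notMem) ..
  have ρ_walk {x y : α} (hxy : K.Adj x y) : Relation.ReflTransGen K'.Adj (ρ x) (ρ y) := by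
    obtain ⟨f, hf⟩ := hxy
    rcases h.edgeSet_eq.subset hf.edge_mem with rfl | hfK'
    · rcases hf.eq_and_eq_or_eq_and_eq h.isLink with ⟨rfl, rfl⟩ | ⟨rfl, rfl⟩ <;>
        rw [ρ_right, ρ_of_mem h.left_mem]
    · have hf' := (h.le.isLink_iff hfK').2 hf
      rw [ρ_of_mem hf'.left_mem, ρ_of_mem hf'.right_mem]
      exact .single ⟨f, hf'⟩
  refine ⟨⟨v, h.left_mem⟩, fun x hx y hy ↦ ?_⟩
  have hwalk : Relation.ReflTransGen K'.Adj (ρ x) (ρ y) :=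
    (hK.2 x (h.le.vertexSet_mono hx) y (h.le.vertexSet_mono hy)).lift' ρ fun _ _ ↦ ρ_walk
  rwa [ρ_of_mem hx, ρ_of_mem hy] at hwalk

lemma two_le_deg_cycle {ℓ : ℕ} (hℓ : 2 ≤ ℓ) (x : ZMod ℓ) : 2 ≤ (cycle ℓ).deg x := by
  have : Fact (1 < ℓ) := ⟨hℓ⟩
  refine two_le_deg_iff.2 ⟨x, x - 1, ?_, ⟨x + 1, rfl⟩, ⟨x - 1, ?_⟩⟩
  · exact fun h ↦ one_ne_zero (sub_eq_self.1 h.symm)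
  · change s(x, x - 1) = s(x - 1, x - 1 + 1)
    rw [sub_add_cancel, Sym2.eq_swap]

lemma two_le_deg_of_mem_cycles (hC : C ∈ G.cycles) : ∀ x ∈ V(C), 2 ≤ C.deg x := by
  obtain ⟨ℓ, hℓ, -, hiso⟩ := hC
  exact two_le_deg_of_isIso hiso fun x _ ↦ two_le_deg_cycle hℓ x

lemma vertexSet_nonempty_of_mem_cycles (hC : C ∈ G.cycles) : V(C).Nonempty := by
  obtain ⟨ℓ, -, -, φ, -, -⟩ := hC
  exact ⟨φ.symm ⟨0, Set.mem_univ _⟩, Subtype.coe_prop _⟩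

lemma le_of_mem_cycles (hC : C ∈ G.cycles) : C ≤ G :=
  hC.choose_spec.2.1

lemma isMulticyclic_of_isTwoCore (hcore : IsTwoCore H' H) (hH : H.IsMulticyclic) :
    H'.IsMulticyclic := by
  refine hH.trans (Set.encard_le_encard fun C hC ↦ ?_)
  have hle : C ≤ H' := hcore.2 ⟨le_of_mem_cycles hC, two_le_deg_of_mem_cycles hC⟩
  obtain ⟨ℓ, hℓ, -, hiso⟩ := hC
  exact ⟨ℓ, hℓ, hle, hiso⟩

lemma vertexSet_nonempty_of_isMulticyclic (hG : G.IsMulticyclic) : V(G).Nonempty := by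
  obtain ⟨C, hC⟩ : G.cycles.Nonempty := Set.encard_pos.1 (two_pos.trans_le hG)
  exact (vertexSet_nonempty_of_mem_cycles hC).mono (le_of_mem_cycles hC).vertexSet_mono

lemma eq_of_inc_of_isTwoCore (hcore : IsTwoCore H' H) {w : α} (hw : V(H) \ V(H') = {w}) {e f : β}
    (he : H.Inc e w) (hf : H.Inc f w) : e = f := by
  by_contra! hef
  have hw' : w ∈ V(H) \ V(H') := hw ▸ rfl
  have hH : H ≤ H' := by
    refine hcore.2 ⟨le_rfl, fun x hx ↦ ?_⟩
    by_cases hxw : x = w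
    · exact hxw ▸ two_le_deg_iff.2 ⟨e, f, hef, he, hf⟩
    · have hx' : x ∈ V(H') := by
        by_contra hx'
        exact hxw (hw.subset ⟨hx, hx'⟩)
      exact two_le_deg_of_le hcore.1.1 (hcore.1.2 x hx')
  exact hw'.2 (hH.vertexSet_mono hw'.1)

lemma induce_le_of_isTwoCore (hcore : IsTwoCore H' H) : H.induce V(H') ≤ H' := by
  obtain ⟨hle, hdeg⟩ := hcore.1
  refine hcore.2 ⟨induce_le hle.vertexSet_mono, fun x hx ↦ ?_⟩
  have hle' : H' ≤ H.induce V(H') :=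
    ⟨subset_rfl, fun _ _ _ hab ↦ ⟨hab.mono hle, hab.left_mem, hab.right_mem⟩⟩
  exact two_le_deg_of_le hle' (hdeg x hx)

lemma exists_isPendantExtension [H.Loopless] (hconn : H.IsConnected) (hmulti : H.IsMulticyclic)
    (hcore : IsTwoCore H' H) (hcard : (V(H) \ V(H')).ncard = 1) :
    ∃ e v w, IsPendantExtension H' H e v w := by
  obtain ⟨w, hw⟩ := Set.ncard_eq_one.1 hcard
  have hle : H' ≤ H := hcore.1.1
  obtain ⟨hwH, hwH'⟩ : w ∈ V(H) \ V(H') := hw ▸ rfl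
  have hV : V(H) = insert w V(H') := by
    rw [← Set.sdiff_union_of_subset hle.vertexSet_mono, hw, Set.singleton_union]
  obtain ⟨x, hx⟩ := vertexSet_nonempty_of_isMulticyclic (isMulticyclic_of_isTwoCore hcore hmulti)
  obtain ⟨v, e, hwv⟩ : ∃ v, H.Adj w v := by
    rcases (hconn.2 w hwH x (hle.vertexSet_mono hx)).cases_head with rfl | ⟨v, hwv, -⟩
    exacts [absurd hx hwH', ⟨v, hwv⟩]
  refine ⟨e, v, w, hle, hwv.symm, (hV.subset hwv.right_mem).resolve_left hwv.ne.symm, hwH', hV, ?_⟩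
  refine Set.Subset.antisymm (fun f hf ↦ ?_) (Set.insert_subset hwv.edge_mem hle.edgeSet_mono)
  refine or_iff_not_imp_left.2 fun hfe ↦ ?_
  obtain ⟨a, b, hab⟩ := exists_isLink_of_mem_edgeSet hf
  have mem_of_inc {y : α} (hy : H.Inc f y) : y ∈ V(H') := (hV.subset hy.vertex_mem).resolve_left
    fun hyw ↦ hfe (eq_of_inc_of_isTwoCore hcore hw (hyw ▸ hy) hwv.inc_left)
  have hab' : (H.induce V(H')).IsLink f a b :=
    ⟨hab, mem_of_inc hab.inc_left, mem_of_inc hab.inc_right⟩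
  exact (hab'.mono (induce_le_of_isTwoCore hcore)).edge_mem

lemma eq_of_mem_cycles_of_deg_eq_two (hG : G.IsConnected) (hdeg : ∀ x ∈ V(G), G.deg x = 2)
    (hC : C ∈ G.cycles) : C = G := by
  have hle := le_of_mem_cycles hC
  refine eq_of_isClosedSubgraph hG (.mk' hle fun e x he hx ↦ ?_)
    (vertexSet_nonempty_of_mem_cycles hC)
  have hxG := hdeg x (hle.vertexSet_mono hx)
  have hfin : (G.incidenceSet x).Finite := Set.finite_of_encard_eq_coe hxG
  have hsub : C.incidenceSet x ⊆ G.incidenceSet x := fun f hf ↦ Inc.mono hle hf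
  have heq : C.incidenceSet x = G.incidenceSet x := (hfin.subset hsub).eq_of_subset_of_encard_le
    hsub (hxG.le.trans (two_le_deg_of_mem_cycles hC x hx))
  exact (heq.symm.subset he).edge_mem

lemma not_isMulticyclic_of_deg_eq_two (hG : G.IsConnected) (hdeg : ∀ x ∈ V(G), G.deg x = 2) :
    ¬ G.IsMulticyclic := fun hmulti ↦ by
  have hle : G.cycles.encard ≤ 1 := Set.encard_le_one_iff.2 fun C D hC hD ↦
    (eq_of_mem_cycles_of_deg_eq_two hG hdeg hC).trans
      (eq_of_mem_cycles_of_deg_eq_two hG hdeg hD).symm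
  exact absurd (hmulti.trans hle) (by norm_num)

lemma card_bipartite_eq_of_card_le {ι κ : Type*} {r : ι → κ → Prop} [∀ i j, Decidable (r i j)]
    {S : Finset ι} {T : Finset κ} {k : ℕ} (habove : ∀ i ∈ S, k ≤ (T.bipartiteAbove r i).card)
    (hbelow : ∀ j ∈ T, (S.bipartiteBelow r j).card ≤ k) (hcard : T.card ≤ S.card) :
    (∀ i ∈ S, (T.bipartiteAbove r i).card = k) ∧ ∀ j ∈ T, (S.bipartiteBelow r j).card = k := by
  have hS : ∑ _i ∈ S, k ≤ ∑ i ∈ S, (T.bipartiteAbove r i).card := Finset.sum_le_sum habove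
  have hT : ∑ j ∈ T, (S.bipartiteBelow r j).card ≤ ∑ _j ∈ T, k := Finset.sum_le_sum hbelow
  have hST : ∑ _j ∈ T, k ≤ ∑ _i ∈ S, k := by
    simpa only [Finset.sum_const, smul_eq_mul] using Nat.mul_le_mul_right k hcard
  have hcount := Finset.sum_card_bipartiteAbove_eq_sum_card_bipartiteBelow (s := S) (t := T) r
  refine ⟨fun i hi ↦ ?_, (Finset.sum_eq_sum_iff_of_le hbelow).1 (by omega)⟩
  exact ((Finset.sum_eq_sum_iff_of_le habove).1 (by omega) i hi).symm

lemma card_filter_inc_le_two {S : Finset α} {e : β} (he : e ∈ E(G))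
    [DecidablePred fun x ↦ G.Inc e x] : (S.filter fun x ↦ G.Inc e x).card ≤ 2 := by
  classical
  obtain ⟨x, y, hxy⟩ := exists_isLink_of_mem_edgeSet he
  refine (Finset.card_le_card (t := {x, y}) fun z hz ↦ ?_).trans Finset.card_le_two
  simpa using (Finset.mem_filter.1 hz).2.eq_or_eq_of_isLink hxy

lemma mem_of_card_filter_inc_eq_two {S : Finset α} {e : β} [DecidablePred fun x ↦ G.Inc e x]
    (hcard : (S.filter fun x ↦ G.Inc e x).card = 2) {x : α} (hx : G.Inc e x) : x ∈ S := by
  classical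
  obtain ⟨a, b, hab, hfilter⟩ := Finset.card_eq_two.1 hcard
  simp only [Finset.ext_iff, Finset.mem_filter, Finset.mem_insert, Finset.mem_singleton] at hfilter
  obtain ⟨y, hxy⟩ := hx
  have ha := ((hfilter a).2 (Or.inl rfl)).2.eq_or_eq_of_isLink hxy
  have hb := ((hfilter b).2 (Or.inr rfl)).2.eq_or_eq_of_isLink hxy
  exact ((hfilter x).2 (by grind)).1

-- Equality in the double count of incidences would make `S` a union of components, hence all of
-- `V(G)`, with all degrees equal to two.
lemma card_lt_card_touching (hG : G.IsConnected) (hdeg : ∀ x ∈ V(G), 2 ≤ G.deg x)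
    (hmulti : G.IsMulticyclic) {S : Finset α} (hS : (S : Set α) ⊆ V(G)) (hne : S.Nonempty)
    {T : Finset β} (hT : ∀ e, e ∈ T ↔ ∃ x ∈ S, G.Inc e x) : S.card < T.card := by
  classical
  by_contra! hcard
  have deg_eq : ∀ x ∈ S, G.deg x = (T.bipartiteAbove (fun x e ↦ G.Inc e x) x).card := by
    intro x hx
    rw [deg, ← Set.encard_coe_eq_coe_finsetCard]
    congr 1
    ext e
    simp only [Finset.mem_coe, Finset.mem_bipartiteAbove, mem_incidenceSet, hT]
    exact ⟨fun he ↦ ⟨⟨x, hx, he⟩, he⟩, And.right⟩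
  obtain ⟨habove, hbelow⟩ := card_bipartite_eq_of_card_le (r := fun x e ↦ G.Inc e x) (k := 2)
    (fun x hx ↦ by exact_mod_cast deg_eq x hx ▸ hdeg x (hS hx))
    (fun e he ↦ card_filter_inc_le_two (((hT e).1 he).choose_spec.2.edge_mem)) hcard
  have hSV : (S : Set α) = V(G) := by
    refine eq_vertexSet_of_adj_closed hG hS hne fun x hx y ⟨e, hxy⟩ ↦ ?_
    exact mem_of_card_filter_inc_eq_two (hbelow e ((hT e).2 ⟨x, hx, hxy.inc_left⟩)) hxy.inc_right
  refine not_isMulticyclic_of_deg_eq_two hG (fun x hx ↦ ?_) hmulti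
  rw [deg_eq x (hSV.symm.subset hx), habove x (hSV.symm.subset hx)]
  rfl

end TwoCore

section LayerCake

open scoped Finset

variable {ι κ : Type*}

lemma sum_eq_sum_card_mul_sub [Fintype ι] {F : ℕ → ℝ} (hF : F 0 = 0) {x : ι → ℕ} {M : ℕ}
    (hM : ∀ i, x i ≤ M) :
    ∑ i, F (x i) = ∑ t ∈ Finset.range M, (#{i | t < x i} : ℝ) * (F (t + 1) - F t) := by
  have hlayers (i : ι) :
      F (x i) = ∑ t ∈ Finset.range M, if t < x i then F (t + 1) - F t else 0 := by
    rw [← Finset.sum_filter, ← sub_zero (F (x i)), ← hF, ← Finset.sum_range_sub]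
    congr 1
    ext t
    have := hM i
    simp only [Finset.mem_filter, Finset.mem_range]
    omega
  simp_rw [hlayers]
  rw [Finset.sum_comm]
  simp_rw [← Finset.sum_filter, Finset.sum_const, nsmul_eq_mul]

lemma mul_sum_le_sum_of_layers [Fintype ι] [Fintype κ] {F : ℕ → ℝ} (hmono : Monotone F)
    (hF : F 0 = 0) {x : ι → ℕ} {y : κ → ℕ} {s : ℝ}
    (h : ∀ t, s * #{i | t < x i} ≤ #{j | t < y j}) :
    s * ∑ i, F (x i) ≤ ∑ j, F (y j) := by
  obtain ⟨M, hMx⟩ := (Set.finite_range x).bddAbove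
  obtain ⟨N, hNy⟩ := (Set.finite_range y).bddAbove
  rw [sum_eq_sum_card_mul_sub hF (M := max M N) fun i ↦ le_max_of_le_left (hMx ⟨i, rfl⟩),
    sum_eq_sum_card_mul_sub hF (M := max M N) fun j ↦ le_max_of_le_right (hNy ⟨j, rfl⟩),
    Finset.mul_sum]
  refine Finset.sum_le_sum fun t _ ↦ ?_
  rw [← mul_assoc]
  exact mul_le_mul_of_nonneg_right (h t) (sub_nonneg.2 (hmono t.le_succ))

lemma monotone_log_natCast : Monotone fun n : ℕ ↦ Real.log n := by
  intro a b hab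
  obtain rfl | ha := a.eq_zero_or_pos
  · simpa using Real.log_natCast_nonneg b
  · exact Real.log_le_log (by exact_mod_cast ha) (by exact_mod_cast hab)

lemma prod_rpow_eq_exp_sum_log [Fintype ι] {x : ι → ℕ} (hx : ∀ i, 0 < x i) (r : ℝ) :
    ∏ i, (x i : ℝ) ^ r = Real.exp (r * ∑ i, Real.log (x i)) := by
  rw [Finset.mul_sum, Real.exp_sum]
  refine Finset.prod_congr rfl fun i _ ↦ ?_
  rw [Real.rpow_def_of_pos (by exact_mod_cast hx i), mul_comm]

lemma prod_inv_le_prod_rpow_of_layers [Fintype ι] [Fintype κ] {x : ι → ℕ} {y : κ → ℕ}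
    (hx : ∀ i, 0 < x i) (hy : ∀ j, 0 < y j) {s : ℝ}
    (h : ∀ t, s * #{i | t < x i} ≤ #{j | t < y j}) :
    ∏ j, (y j : ℝ)⁻¹ ≤ ∏ i, (x i : ℝ) ^ (-s) := by
  have hlog : s * ∑ i, Real.log (x i) ≤ ∑ j, Real.log (y j) :=
    mul_sum_le_sum_of_layers monotone_log_natCast (by simp) h
  simp_rw [← Real.rpow_neg_one]
  rw [prod_rpow_eq_exp_sum_log hx, prod_rpow_eq_exp_sum_log hy]
  exact Real.exp_le_exp.2 (by linarith)

lemma tsum_pi_prod_le [Fintype ι] (f : ι → κ → ℝ≥0∞) :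
    ∑' φ : ι → κ, ∏ i, f i (φ i) ≤ ∏ i, ∑' k, f i k := by
  classical
  rw [ENNReal.tsum_eq_iSup_sum]
  refine iSup_le fun s ↦ ?_
  let t : Finset κ := s.biUnion fun φ ↦ Finset.univ.image φ
  have hst : s ⊆ Fintype.piFinset fun _ : ι ↦ t := fun φ hφ ↦ Fintype.mem_piFinset.2 fun i ↦
    Finset.mem_biUnion.2 ⟨φ, hφ, Finset.mem_image_of_mem _ (Finset.mem_univ i)⟩
  calc ∑ φ ∈ s, ∏ i, f i (φ i) ≤ ∑ φ ∈ Fintype.piFinset fun _ : ι ↦ t, ∏ i, f i (φ i) :=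
        Finset.sum_le_sum_of_subset hst
    _ = ∏ i, ∑ k ∈ t, f i k := (Finset.prod_univ_sum (fun _ ↦ t) f).symm
    _ ≤ ∏ i, ∑' k, f i k := Finset.prod_le_prod' fun i _ ↦ ENNReal.sum_le_tsum t

end LayerCake

section Finiteness

open scoped Finset

variable {α β ι κ Ω : Type*} [MeasurableSpace Ω] {μ : Measure Ω} {m : ℕ} {U : ℕ → Fin m → Ω → ℕ}

/-- `φ` places a graph with vertex set `ι` and edge set `κ`, whose edge `e` joins `x e` and `y e`,
in the attachment graph with choices `f`, so that the edge `e` becomes the edge with label `l e`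
born with the later one of its ends. -/
structure IsPlacement (f : ℕ → Fin m → ℕ) (x y : κ → ι) (l : κ → Fin m) (φ : ι → ℕ) : Prop where
  injective : φ.Injective
  pos : ∀ v, 0 < φ v
  edge_injective : Function.Injective fun e ↦ (max (φ (x e)) (φ (y e)), l e)
  apply_max : ∀ e, f (max (φ (x e)) (φ (y e))) (l e) = min (φ (x e)) (φ (y e))

lemma inv_natCast_sub_one_le {n : ℕ} (hn : 2 ≤ n) :
    ((n - 1 : ℕ) : ℝ≥0∞)⁻¹ ≤ ENNReal.ofReal (2 * (n : ℝ)⁻¹) := by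
  have hpos : (0 : ℝ) < (n - 1 : ℕ) := by exact_mod_cast Nat.sub_pos_of_lt hn
  rw [← ENNReal.ofReal_natCast, ← ENNReal.ofReal_inv_of_pos hpos]
  refine ENNReal.ofReal_le_ofReal ?_
  rw [← div_eq_mul_inv, inv_le_comm₀ hpos (by positivity), inv_div, div_le_iff₀ two_pos]
  exact_mod_cast (by omega : n ≤ (n - 1) * 2)

namespace IsUniformAttachment

lemma measure_forall_eq (hU : IsUniformAttachment U μ) [Fintype κ] {j i : κ → ℕ} {l : κ → Fin m}
    (hi : ∀ e, 0 < i e) (hij : ∀ e, i e < j e) (hinj : Function.Injective fun e ↦ (j e, l e)) :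
    μ {ω | ∀ e, U (j e) (l e) ω = i e} = ∏ e, ((j e - 1 : ℕ) : ℝ≥0∞)⁻¹ := by
  have hj (e : κ) : 2 ≤ j e := (Nat.succ_le_succ (hi e)).trans (hij e)
  let g : κ → {j : ℕ // 2 ≤ j} × Fin m := fun e ↦ (⟨j e, hj e⟩, l e)
  have hg : g.Injective := .of_comp (f := Prod.map Subtype.val id) hinj
  have hset : {ω | ∀ e, U (j e) (l e) ω = i e} =
      ⋂ e ∈ (Finset.univ : Finset κ), (fun ω ↦ U (j e) (l e) ω) ⁻¹' {i e} := by
    ext ω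
    simp
  rw [hset, (hU.indep.precomp hg).measure_inter_preimage_eq_mul Finset.univ
    (sets := fun e ↦ {i e}) fun _ _ ↦ .of_discrete]
  refine Finset.prod_congr rfl fun e _ ↦ ?_
  exact (hU.uniform (j e) (hj e) (l e) (i e) (hi e) (hij e)).trans (one_div _)

lemma measure_isPlacement_le (hU : IsUniformAttachment U μ) [Fintype ι] [Fintype κ]
    {x y : κ → ι} (hxy : ∀ e, x e ≠ y e) (l : κ → Fin m) {s : ℝ} {φ : ι → ℕ}
    (hs : ∀ t, s * #{i | t < φ i} ≤ #{e | t < max (φ (x e)) (φ (y e))}) :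
    μ {ω | IsPlacement (fun j a ↦ U j a ω) x y l φ} ≤
      2 ^ Fintype.card κ * ∏ i, ENNReal.ofReal ((φ i : ℝ) ^ (-s)) := by
  obtain hempty | ⟨ω₀, hω₀⟩ := {ω | IsPlacement (fun j a ↦ U j a ω) x y l φ}.eq_empty_or_nonempty
  · simp [hempty]
  let j : κ → ℕ := fun e ↦ max (φ (x e)) (φ (y e))
  have hi (e : κ) : 0 < min (φ (x e)) (φ (y e)) := lt_min (hω₀.pos _) (hω₀.pos _)
  have hij (e : κ) : min (φ (x e)) (φ (y e)) < j e :=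
    min_lt_max.2 fun h ↦ hxy e (hω₀.injective h)
  calc μ {ω | IsPlacement (fun j a ↦ U j a ω) x y l φ}
      ≤ μ {ω | ∀ e, U (j e) (l e) ω = min (φ (x e)) (φ (y e))} :=
        measure_mono fun ω hω ↦ hω.apply_max
    _ = ∏ e, ((j e - 1 : ℕ) : ℝ≥0∞)⁻¹ := hU.measure_forall_eq hi hij hω₀.edge_injective
    _ ≤ ∏ e, ENNReal.ofReal (2 * (j e : ℝ)⁻¹) := Finset.prod_le_prod' fun e _ ↦
        inv_natCast_sub_one_le ((Nat.succ_le_succ (hi e)).trans (hij e))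
    _ = ENNReal.ofReal (2 ^ Fintype.card κ * ∏ e, (j e : ℝ)⁻¹) := by
        rw [← ENNReal.ofReal_prod_of_nonneg fun _ _ ↦ by positivity, Finset.prod_mul_distrib,
          Finset.prod_const, Finset.card_univ]
    _ ≤ ENNReal.ofReal (2 ^ Fintype.card κ * ∏ i, (φ i : ℝ) ^ (-s)) := by
        gcongr
        exact prod_inv_le_prod_rpow_of_layers hω₀.pos (fun e ↦ (hi e).trans (hij e)) hs
    _ = _ := by
        rw [ENNReal.ofReal_mul (by positivity), ENNReal.ofReal_prod_of_nonneg fun _ _ ↦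
          by positivity, ENNReal.ofReal_pow zero_le_two, ENNReal.ofReal_ofNat]

-- `1 + 1 / |ι|` is a common lower bound for the ratios `(|S| + 1) / |S|` with `S ⊆ ι`.
lemma ae_finite_isPlacement (hU : IsUniformAttachment U μ) [Finite ι] [Fintype κ] [Nonempty ι]
    [DecidableEq ι] {x y : κ → ι} (hxy : ∀ e, x e ≠ y e)
    (htouch : ∀ S : Finset ι, S.Nonempty → #S < #{e | x e ∈ S ∨ y e ∈ S}) (l : κ → Fin m) :
    ∀ᵐ ω ∂μ, {φ | IsPlacement (fun j a ↦ U j a ω) x y l φ}.Finite := by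
  have := Fintype.ofFinite ι
  set s : ℝ := 1 + (Fintype.card ι : ℝ)⁻¹ with hs
  have hcard : (0 : ℝ) < Fintype.card ι := by exact_mod_cast Fintype.card_pos
  have hlayers (φ : ι → ℕ) (t : ℕ) :
      s * #{i | t < φ i} ≤ #{e | t < max (φ (x e)) (φ (y e))} := by
    obtain hempty | hne := (Finset.univ.filter fun i ↦ t < φ i).eq_empty_or_nonempty
    · simp [hempty]
    have htouch' := htouch _ hne
    simp only [Finset.mem_filter, Finset.mem_univ, true_and, ← lt_max_iff] at htouch'
    have hle : (#{i | t < φ i} : ℝ) ≤ Fintype.card ι := by exact_mod_cast Finset.card_le_univ _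
    calc s * #{i | t < φ i} = #{i | t < φ i} + #{i | t < φ i} / (Fintype.card ι : ℝ) := by
          rw [hs]
          ring
      _ ≤ #{i | t < φ i} + 1 := by
          gcongr
          exact div_le_one_of_le₀ hle hcard.le
      _ ≤ #{e | t < max (φ (x e)) (φ (y e))} := by exact_mod_cast htouch'
  have hsummable : Summable fun n : ℕ ↦ (n : ℝ) ^ (-s) :=
    Real.summable_nat_rpow.2 (by linarith [inv_pos.2 hcard])
  refine ae_finite_setOfPred_mem (s := fun φ ↦ {ω | IsPlacement (fun j a ↦ U j a ω) x y l φ})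
    (ne_top_of_le_ne_top ?_ (ENNReal.tsum_le_tsum fun φ ↦
      hU.measure_isPlacement_le hxy l (hlayers φ)))
  rw [ENNReal.tsum_mul_left]
  refine ENNReal.mul_ne_top (by finiteness) (ne_top_of_le_ne_top ?_ <|
    tsum_pi_prod_le fun _ (n : ℕ) ↦ ENNReal.ofReal ((n : ℝ) ^ (-s)))
  exact ENNReal.prod_ne_top fun _ _ ↦ hsummable.tsum_ofReal_ne_top

end IsUniformAttachment

open Graph

lemma card_lt_card_filter_ends {G : Graph α β} (hG : G.IsConnected)
    (hdeg : ∀ v ∈ V(G), 2 ≤ G.deg v) (hmulti : G.IsMulticyclic) [Fintype E(G)]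
    [DecidableEq V(G)] {x y : E(G) → V(G)} (hxy : ∀ e : E(G), G.IsLink e (x e) (y e))
    {S : Finset V(G)} (hS : S.Nonempty) : #S < #{e | x e ∈ S ∨ y e ∈ S} := by
  have inc_iff (e : E(G)) (v : V(G)) : G.Inc e v ↔ v = x e ∨ v = y e := by
    refine ⟨fun h ↦ (h.eq_or_eq_of_isLink (hxy e)).imp Subtype.ext Subtype.ext, ?_⟩
    rintro (rfl | rfl)
    exacts [(hxy e).inc_left, (hxy e).inc_right]
  have hlt := card_lt_card_touching hG hdeg hmulti (S := S.map (.subtype _))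
    (T := (Finset.univ.filter fun e ↦ x e ∈ S ∨ y e ∈ S).map (.subtype _))
    (fun v hv ↦ Finset.property_of_mem_map_subtype S hv) (hS.map) fun e ↦ ?_
  · simpa only [Finset.card_map] using hlt
  simp only [Finset.mem_map, Finset.mem_filter, Finset.mem_univ, true_and,
    Function.Embedding.subtype_apply]
  constructor
  · rintro ⟨e, h | h, rfl⟩
    exacts [⟨_, ⟨_, h, rfl⟩, (hxy e).inc_left⟩, ⟨_, ⟨_, h, rfl⟩, (hxy e).inc_right⟩]
  · rintro ⟨_, ⟨v, hv, rfl⟩, hinc⟩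
    refine ⟨⟨e, hinc.edge_mem⟩, ?_, rfl⟩
    rcases (inc_iff ⟨e, hinc.edge_mem⟩ v).1 hinc with h | h
    exacts [Or.inl (h ▸ hv), Or.inr (h ▸ hv)]

lemma eq_max_and_apply_eq_min_of_isLink {f : ℕ → Fin m → ℕ} {n : ℕ∞} {e : ℕ × Fin m} {x y : ℕ}
    (h : (attachmentGraph f n).IsLink e x y) : e.1 = max x y ∧ f e.1 e.2 = min x y := by
  obtain ⟨-, -, ⟨-, hlt⟩, hends⟩ := h
  rcases Sym2.eq_iff.1 hends with ⟨rfl, rfl⟩ | ⟨rfl, rfl⟩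
  · exact ⟨(max_eq_left hlt.le).symm, (min_eq_right hlt.le).symm⟩
  · exact ⟨(max_eq_right hlt.le).symm, (min_eq_left hlt.le).symm⟩

lemma exists_isPlacement_of_mem_copies {G : Graph α β} {x y : E(G) → V(G)}
    (hxy : ∀ e : E(G), G.IsLink e (x e) (y e)) {f : ℕ → Fin m → ℕ} {n : ℕ∞}
    {K : Graph ℕ (ℕ × Fin m)} (hK : K ∈ copies G (attachmentGraph f n)) :
    ∃ l φ, IsPlacement f x y l φ ∧ V(K) = Set.range φ ∧
      E(K) = Set.range fun e ↦ (max (φ (x e)) (φ (y e)), l e) := by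
  obtain ⟨hle, φ, ψ, hlink⟩ := hK
  have isLink (e : E(G)) : K.IsLink (ψ.symm e) (φ.symm (x e)) (φ.symm (y e)) :=
    (hlink _ _ _).2 (by simpa using hxy e)
  have hmax (e : E(G)) := eq_max_and_apply_eq_min_of_isLink ((isLink e).mono hle)
  have hedge : (fun e ↦ (max (φ.symm (x e) : ℕ) (φ.symm (y e)), (ψ.symm e : ℕ × Fin m).2)) =
      fun e ↦ (ψ.symm e : ℕ × Fin m) := funext fun e ↦ Prod.ext (hmax e).1.symm rfl
  refine ⟨fun e ↦ (ψ.symm e : ℕ × Fin m).2, fun v ↦ φ.symm v, ⟨?_, ?_, ?_, ?_⟩, ?_, ?_⟩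
  · exact Subtype.val_injective.comp φ.symm.injective
  · exact fun v ↦ (hle.vertexSet_mono (φ.symm v).2).1
  · rw [hedge]
    exact Subtype.val_injective.comp ψ.symm.injective
  · exact fun e ↦ by simpa only [(hmax e).1] using (hmax e).2
  · exact (Subtype.range_coe.symm.trans (φ.symm.surjective.range_comp _).symm)
  · rw [hedge]
    exact (Subtype.range_coe.symm.trans (ψ.symm.surjective.range_comp _).symm)

lemma injOn_vertexSet_edgeSet (G : Graph α β) : Set.InjOn (fun K ↦ (V(K), E(K))) {K | K ≤ G} :=
  fun _ hK _ hL h ↦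
    (Compatible.of_le_le hK hL).ext (congrArg Prod.fst h) (congrArg Prod.snd h)

lemma IsUniformAttachment.ae_finite_copies (hU : IsUniformAttachment U μ) {G : Graph α β}
    [G.Loopless] (hV : V(G).Finite) (hE : E(G).Finite) (hG : G.IsConnected)
    (hdeg : ∀ v ∈ V(G), 2 ≤ G.deg v) (hmulti : G.IsMulticyclic) :
    ∀ᵐ ω ∂μ, (copies G (attachmentGraph (fun j a ↦ U j a ω) ⊤)).Finite := by
  classical
  have := hV.fintype
  have := hE.fintype
  have : Nonempty V(G) := hG.1.to_subtype
  have exists_ends (e : E(G)) : ∃ x y : V(G), G.IsLink e x y := by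
    obtain ⟨a, b, hab⟩ := exists_isLink_of_mem_edgeSet e.2
    exact ⟨⟨a, hab.left_mem⟩, ⟨b, hab.right_mem⟩, hab⟩
  choose x y hxy using exists_ends
  have hne (e : E(G)) : x e ≠ y e := fun h ↦ (hxy e).ne (congrArg Subtype.val h)
  filter_upwards [ae_all_iff.2 fun l ↦ hU.ae_finite_isPlacement hne
    (fun S ↦ card_lt_card_filter_ends hG hdeg hmulti hxy) l] with ω hω
  refine .of_finite_image (f := fun K ↦ (V(K), E(K))) ?_
    ((injOn_vertexSet_edgeSet _).mono fun K hK ↦ hK.1)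
  refine (Set.finite_iUnion fun l ↦ (hω l).image fun φ ↦
    (Set.range φ, Set.range fun e ↦ (max (φ (x e)) (φ (y e)), l e))).subset ?_
  rintro _ ⟨K, hK, rfl⟩
  obtain ⟨l, φ, hφ, hVK, hEK⟩ := exists_isPlacement_of_mem_copies hxy hK
  exact Set.mem_iUnion.2 ⟨l, φ, hφ, Prod.ext hVK.symm hEK.symm⟩

end Finiteness

section StrongLaw

variable {S a : ℕ → ℝ} {N : ℝ → ℕ}

lemma exists_galoisConnection_of_tendsto_atTop (hmono : Monotone a) (ha : Tendsto a atTop atTop) :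
    ∃ N : ℝ → ℕ, GaloisConnection N a := by
  classical
  have hex (x : ℝ) : ∃ n, x ≤ a n := (ha.eventually_ge_atTop x).exists
  exact ⟨fun x ↦ Nat.find (hex x), fun x n ↦
    ⟨fun h ↦ (Nat.find_spec (hex x)).trans (hmono h), fun h ↦ Nat.find_le h⟩⟩

lemma apply_le_add_one_of_galoisConnection (hN : GaloisConnection N a) (h0 : a 0 = 0)
    (hstep : ∀ n, a (n + 1) ≤ a n + 1) {x : ℝ} (hx : 0 ≤ x) : a (N x) ≤ x + 1 := by
  rcases hNx : N x with _ | n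
  · linarith
  · have : a n < x := hN.lt_iff_lt.1 (by omega)
    linarith [hstep n]

lemma tendsto_div_of_tendsto_div_sq (hN : GaloisConnection N a) (ha : Tendsto a atTop atTop)
    (hmono : Monotone S) (hS : ∀ n, 0 ≤ S n)
    (h : Tendsto (fun k : ℕ ↦ S (N ((k : ℝ) ^ 2)) / (k : ℝ) ^ 2) atTop (𝓝 1)) :
    Tendsto (fun n ↦ S n / a n) atTop (𝓝 1) := by
  let q : ℕ → ℕ := fun n ↦ ⌊√(a n)⌋₊
  have hq : Tendsto q atTop atTop :=
    tendsto_nat_floor_atTop.comp (Real.tendsto_sqrt_atTop.comp ha)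
  have hratio : Tendsto (fun k : ℕ ↦ ((k : ℝ) / (k + 1)) ^ 2) atTop (𝓝 1) := by
    simpa using (tendsto_natCast_div_add_atTop (1 : ℝ)).pow 2
  have hlow : Tendsto (fun k : ℕ ↦ S (N ((k : ℝ) ^ 2)) / ((k : ℝ) + 1) ^ 2) atTop (𝓝 1) := by
    refine (mul_one (1 : ℝ) ▸ h.mul hratio).congr' ?_
    filter_upwards [eventually_gt_atTop 0] with k hk
    field_simp
  have hup : Tendsto (fun k : ℕ ↦ S (N (((k : ℝ) + 1) ^ 2)) / (k : ℝ) ^ 2) atTop (𝓝 1) := by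
    refine (div_one (1 : ℝ) ▸ ((tendsto_add_atTop_iff_nat 1).2 h).div hratio one_ne_zero).congr' ?_
    filter_upwards [eventually_gt_atTop 0] with k hk
    simp only [Pi.div_apply]
    push_cast
    field_simp
  refine tendsto_of_tendsto_of_tendsto_of_le_of_le' (hlow.comp hq) (hup.comp hq) ?_ ?_ <;>
    filter_upwards [ha.eventually_gt_atTop 0, hq.eventually_gt_atTop 0] with n hn hqn
  all_goals
    have hq_le : (q n : ℝ) ^ 2 ≤ a n :=
      (Real.le_sqrt (by positivity) hn.le).1 (Nat.floor_le (Real.sqrt_nonneg _))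
    have hlt_q : a n < ((q n : ℝ) + 1) ^ 2 :=
      (Real.sqrt_lt' (by positivity)).1 (Nat.lt_floor_add_one _)
  · exact div_le_div₀ (hS n) (hmono ((hN _ _).2 hq_le)) hn hlt_q.le
  · exact div_le_div₀ (hS _) (hmono (hN.lt_iff_lt.2 hlt_q).le) (by positivity) hq_le

variable {Ω : Type*} [MeasurableSpace Ω] {μ : Measure Ω}

lemma ae_tendsto_sub_integral_of_summable_variance [IsFiniteMeasure μ] {Z : ℕ → Ω → ℝ}
    (hZ : ∀ k, MemLp (Z k) 2 μ) (hsum : Summable fun k ↦ Var[Z k; μ]) :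
    ∀ᵐ ω ∂μ, Tendsto (fun k ↦ Z k ω - μ[Z k]) atTop (𝓝 0) := by
  have hmeas (k : ℕ) : AEMeasurable (fun ω ↦ ‖Z k ω - μ[Z k]‖ₑ ^ 2) μ :=
    ((hZ k).aemeasurable.sub_const _).enorm.pow_const 2
  have hlintegral : ∫⁻ ω, ∑' k, ‖Z k ω - μ[Z k]‖ₑ ^ 2 ∂μ ≠ ⊤ := by
    rw [lintegral_tsum hmeas]
    exact (tsum_congr fun k ↦ ofReal_variance (hZ k)) ▸ hsum.tsum_ofReal_ne_top
  filter_upwards [ae_lt_top' (.tsum hmeas) hlintegral] with ω hω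
  have hsq := ENNReal.tendsto_atTop_zero_of_tsum_ne_top hω.ne
  rw [tendsto_zero_iff_enorm_tendsto_zero]
  have hroot := (ENNReal.continuous_rpow_const (y := (2 : ℝ)⁻¹)).tendsto 0 |>.comp hsq
  rw [ENNReal.zero_rpow_of_pos (by norm_num)] at hroot
  refine hroot.congr fun k ↦ ?_
  exact ENNReal.pow_rpow_inv_natCast two_ne_zero _

lemma memLp_two_of_mem_Icc_zero_one [IsFiniteMeasure μ] {Y : Ω → ℝ} (hY : Measurable Y)
    (h01 : ∀ ω, Y ω ∈ Set.Icc 0 1) : MemLp Y 2 μ :=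
  memLp_of_bounded (ae_of_all _ h01) hY.aestronglyMeasurable 2

variable [IsProbabilityMeasure μ] {X : ℕ → Ω → ℝ}

lemma variance_sum_le_sum_integral (hX : ∀ j, Measurable (X j))
    (h01 : ∀ j ω, X j ω ∈ Set.Icc 0 1) (hindep : Pairwise fun i j ↦ X i ⟂ᵢ[μ] X j) (s : Finset ℕ) :
    Var[∑ j ∈ s, X j; μ] ≤ ∑ j ∈ s, μ[X j] := by
  rw [IndepFun.variance_sum
    (fun j _ ↦ memLp_two_of_mem_Icc_zero_one (hX j) (h01 j))
    (hindep.set_pairwise _)]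
  refine Finset.sum_le_sum fun j _ ↦ ?_
  have hvar := variance_le_sub_mul_sub (ae_of_all μ (h01 j)) (hX j).aemeasurable
  nlinarith [sq_nonneg (μ[X j])]

lemma ae_tendsto_sum_sub_div_sq (hX : ∀ j, Measurable (X j)) (h01 : ∀ j ω, X j ω ∈ Set.Icc 0 1)
    (hindep : Pairwise fun i j ↦ X i ⟂ᵢ[μ] X j) {M : ℕ → ℕ}
    (hM : ∀ k, ∑ j ∈ Finset.range (M k), μ[X j] ≤ (k : ℝ) ^ 2 + 1) :
    ∀ᵐ ω ∂μ, Tendsto (fun k ↦ (∑ j ∈ Finset.range (M k), X j ω -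
      ∑ j ∈ Finset.range (M k), μ[X j]) / (k : ℝ) ^ 2) atTop (𝓝 0) := by
  have hLp (j : ℕ) : MemLp (X j) 2 μ := memLp_two_of_mem_Icc_zero_one (hX j) (h01 j)
  let Z : ℕ → Ω → ℝ := fun k ω ↦ ((k : ℝ) ^ 2)⁻¹ * (∑ j ∈ Finset.range (M k), X j) ω
  have hmean (k : ℕ) : μ[Z k] = ((k : ℝ) ^ 2)⁻¹ * ∑ j ∈ Finset.range (M k), μ[X j] := by
    simp only [Z, Finset.sum_apply]
    rw [integral_const_mul, integral_finsetSum _ fun j _ ↦ (hLp j).integrable one_le_two]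
  have hscale (k : ℕ) :
      Var[Z k; μ] = (((k : ℝ) ^ 2)⁻¹) ^ 2 * Var[∑ j ∈ Finset.range (M k), X j; μ] :=
    variance_const_mul _ _ _
  have hvar (k : ℕ) : Var[Z k; μ] ≤ 2 * (1 / (k : ℝ) ^ 2) := by
    obtain rfl | hk := k.eq_zero_or_pos
    · simp [hscale]
    have hk1 : (1 : ℝ) ≤ (k : ℝ) ^ 2 := one_le_pow₀ (by exact_mod_cast hk)
    calc Var[Z k; μ] = (((k : ℝ) ^ 2)⁻¹) ^ 2 * Var[∑ j ∈ Finset.range (M k), X j; μ] :=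
          hscale k
      _ ≤ (((k : ℝ) ^ 2)⁻¹) ^ 2 * (2 * (k : ℝ) ^ 2) := by
          gcongr
          linarith [variance_sum_le_sum_integral hX h01 hindep (Finset.range (M k)), hM k]
      _ = 2 * (1 / (k : ℝ) ^ 2) := by field_simp
  have hsummable : Summable fun k ↦ Var[Z k; μ] :=
    .of_nonneg_of_le (fun _ ↦ variance_nonneg _ _) hvar
      ((Real.summable_one_div_nat_pow.2 one_lt_two).mul_left 2)
  filter_upwards [ae_tendsto_sub_integral_of_summable_variance (Z := Z)
    (fun k ↦ (memLp_finsetSum' _ fun j _ ↦ hLp j).const_mul _) hsummable] with ω hω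
  refine hω.congr fun k ↦ ?_
  rw [hmean]
  simp only [Z, Finset.sum_apply]
  ring

-- Along the first `n` at which the mean passes `k ^ 2`, Chebyshev's bound is summable in `k`; by
-- monotonicity this subsequence determines the growth of the whole sequence.
lemma ae_tendsto_sum_div_sum_integral (hX : ∀ j, Measurable (X j))
    (h01 : ∀ j ω, X j ω ∈ Set.Icc 0 1) (hindep : Pairwise fun i j ↦ X i ⟂ᵢ[μ] X j)
    (hdiv : Tendsto (fun n ↦ ∑ j ∈ Finset.range n, μ[X j]) atTop atTop) :
    ∀ᵐ ω ∂μ, Tendsto (fun n ↦ (∑ j ∈ Finset.range n, X j ω) / ∑ j ∈ Finset.range n, μ[X j])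
      atTop (𝓝 1) := by
  let S : ℕ → Ω → ℝ := fun n ω ↦ ∑ j ∈ Finset.range n, X j ω
  let a : ℕ → ℝ := fun n ↦ ∑ j ∈ Finset.range n, μ[X j]
  have hLp (j : ℕ) : MemLp (X j) 2 μ :=
    memLp_two_of_mem_Icc_zero_one (hX j) (h01 j)
  have hmean_le (j : ℕ) : μ[X j] ≤ 1 := by
    simpa using integral_mono ((hLp j).integrable one_le_two) (integrable_const 1)
      fun ω ↦ (h01 j ω).2
  have hmono : Monotone a := monotone_nat_of_le_succ fun n ↦ by
    simpa [a, Finset.sum_range_succ] using integral_nonneg fun ω ↦ (h01 n ω).1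
  obtain ⟨N, hN⟩ := exists_galoisConnection_of_tendsto_atTop hmono hdiv
  have ha_le (k : ℕ) : a (N ((k : ℝ) ^ 2)) ≤ (k : ℝ) ^ 2 + 1 :=
    apply_le_add_one_of_galoisConnection hN (by simp [a])
      (fun n ↦ by simpa [a, Finset.sum_range_succ] using hmean_le n) (by positivity)
  have hsq : Tendsto (fun k : ℕ ↦ (k : ℝ) ^ 2) atTop atTop :=
    (tendsto_pow_atTop two_ne_zero).comp tendsto_natCast_atTop_atTop
  have hratio : Tendsto (fun k : ℕ ↦ a (N ((k : ℝ) ^ 2)) / (k : ℝ) ^ 2) atTop (𝓝 1) := by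
    refine tendsto_of_tendsto_of_tendsto_of_le_of_le' tendsto_const_nhds
      (by simpa using tendsto_const_nhds.add (hsq.const_div_atTop 1) (a := (1 : ℝ))) ?_ ?_ <;>
      filter_upwards [hsq.eventually_gt_atTop 0] with k hk
    · exact (one_le_div hk).2 (hN.le_u_l _)
    · rw [div_le_iff₀ hk, add_mul, inv_mul_cancel₀ hk.ne', one_mul]
      exact ha_le k
  filter_upwards [ae_tendsto_sum_sub_div_sq hX h01 hindep ha_le] with ω hω
  refine tendsto_div_of_tendsto_div_sq (S := fun n ↦ S n ω) hN hdiv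
    (monotone_nat_of_le_succ fun n ↦ ?_) (fun n ↦ Finset.sum_nonneg fun j _ ↦ (h01 j ω).1) ?_
  · simpa [S, Finset.sum_range_succ] using (h01 n ω).1
  · refine (zero_add (1 : ℝ) ▸ hω.add hratio).congr fun k ↦ ?_
    rw [← add_div, sub_add_cancel]

end StrongLaw

section InDegree

open scoped Finset

variable {m : ℕ}

/-- The number of edges with label `a`, born by time `n`, that have the vertex `v` as their earlier
end, in the attachment graph with choices `f`. -/
def inDegree (f : ℕ → Fin m → ℕ) (a : Fin m) (v n : ℕ) : ℕ :=
  #{j ∈ Finset.Ioc v n | f j a = v}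

lemma cast_inDegree_add (f : ℕ → Fin m → ℕ) (a : Fin m) (v k : ℕ) :
    (inDegree f a v (k + v) : ℝ) =
      ∑ i ∈ Finset.range k, ({v} : Set ℕ).indicator 1 (f (v + 1 + i) a) := by
  rw [inDegree, ← Finset.Ico_add_one_add_one_eq_Ioc, Finset.card_filter,
    Finset.sum_Ico_eq_sum_range, Nat.add_sub_add_right, Nat.add_sub_cancel, Nat.cast_sum]
  simp [Set.indicator_apply]

lemma exists_tendsto_sum_inv_sub_log (v : ℕ) :
    ∃ c : ℝ, Tendsto (fun k : ℕ ↦ (∑ i ∈ Finset.range k, ((v + i : ℕ) : ℝ)⁻¹) -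
      Real.log (k + v : ℕ)) atTop (𝓝 c) := by
  have hγ : Tendsto (fun n : ℕ ↦ ∑ i ∈ Finset.range n, (i : ℝ)⁻¹ - Real.log n) atTop
      (𝓝 Real.eulerMascheroniConstant) := by
    refine (tendsto_add_atTop_iff_nat 1).1 (Real.tendsto_harmonic_sub_log_add_one.congr fun n ↦ ?_)
    rw [Finset.sum_range_succ', harmonic]
    push_cast
    simp
  refine ⟨_, (((tendsto_add_atTop_iff_nat v).2 hγ).sub_const
    (∑ i ∈ Finset.range v, (i : ℝ)⁻¹)).congr fun k ↦ ?_⟩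
  rw [add_comm k v, Finset.sum_range_add]
  ring

lemma tendsto_div_of_tendsto_sub {ι : Type*} {l : Filter ι} {u w : ι → ℝ} {c : ℝ}
    (hw : Tendsto w l atTop) (h : Tendsto (fun i ↦ u i - w i) l (𝓝 c)) :
    Tendsto (fun i ↦ u i / w i) l (𝓝 1) := by
  refine (zero_add (1 : ℝ) ▸ (h.div_atTop hw).add_const 1).congr' ?_
  filter_upwards [hw.eventually_ne_atTop 0] with i hi
  rw [sub_div, div_self hi, sub_add_cancel]

lemma tendsto_log_natCast : Tendsto (fun n : ℕ ↦ Real.log n) atTop atTop :=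
  Real.tendsto_log_atTop.comp tendsto_natCast_atTop_atTop

namespace IsUniformAttachment

variable {Ω : Type*} [MeasurableSpace Ω] {μ : Measure Ω} {U : ℕ → Fin m → Ω → ℕ}

lemma integral_indicator_singleton (hU : IsUniformAttachment U μ) (a : Fin m) {v j : ℕ}
    (hv : 0 < v) (hvj : v < j) :
    ∫ ω, ({v} : Set ℕ).indicator (1 : ℕ → ℝ) (U j a ω) ∂μ = ((j - 1 : ℕ) : ℝ)⁻¹ := by
  have hj : 2 ≤ j := (Nat.succ_le_succ hv).trans hvj
  have hmeas : MeasurableSet (U j a ⁻¹' {v}) := hU.measurable j hj a .of_discrete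
  calc ∫ ω, ({v} : Set ℕ).indicator (1 : ℕ → ℝ) (U j a ω) ∂μ
      = ∫ ω, (U j a ⁻¹' {v}).indicator 1 ω ∂μ := rfl
    _ = μ.real {ω | U j a ω = v} := integral_indicator_one hmeas
    _ = ((j - 1 : ℕ) : ℝ)⁻¹ := by
      rw [Measure.real, hU.uniform j hj a v hv hvj, one_div, ENNReal.toReal_inv,
        ENNReal.toReal_natCast]

lemma ae_tendsto_inDegree_div_log [IsProbabilityMeasure μ] (hU : IsUniformAttachment U μ)
    {v : ℕ} (hv : 0 < v) (a : Fin m) :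
    ∀ᵐ ω ∂μ, Tendsto (fun n : ℕ ↦ (inDegree (fun j b ↦ U j b ω) a v n : ℝ) / Real.log n) atTop
      (𝓝 1) := by
  let g : ℕ → ℝ := ({v} : Set ℕ).indicator 1
  let X : ℕ → Ω → ℝ := fun i ω ↦ g (U (v + 1 + i) a ω)
  have hg : Measurable g := .of_discrete
  have htwo (i : ℕ) : 2 ≤ v + 1 + i := by omega
  have hX (i : ℕ) : Measurable (X i) := hg.comp (hU.measurable _ (htwo i) a)
  have h01 (i : ℕ) (ω : Ω) : X i ω ∈ Set.Icc 0 1 :=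
    ⟨Set.indicator_nonneg (fun _ _ ↦ zero_le_one) _,
      Set.indicator_le_self' (fun _ _ ↦ zero_le_one) _⟩
  have hindep : Pairwise fun i j ↦ X i ⟂ᵢ[μ] X j := fun i j hij ↦
    (hU.indep.indepFun (i := (⟨_, htwo i⟩, a)) (j := (⟨_, htwo j⟩, a)) (by simpa using hij)).comp
      hg hg
  have hmean (i : ℕ) : μ[X i] = ((v + i : ℕ) : ℝ)⁻¹ := by
    simpa [X, g, Nat.add_right_comm] using
      hU.integral_indicator_singleton a hv (by omega : v < v + 1 + i)
  have hlog : Tendsto (fun k : ℕ ↦ Real.log (k + v : ℕ)) atTop atTop :=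
    (tendsto_add_atTop_iff_nat v).2 tendsto_log_natCast
  obtain ⟨c, hc⟩ := exists_tendsto_sum_inv_sub_log v
  simp_rw [← hmean] at hc
  have hdiv : Tendsto (fun k ↦ ∑ i ∈ Finset.range k, μ[X i]) atTop atTop :=
    (hc.add_atTop hlog).congr fun k ↦ sub_add_cancel _ _
  filter_upwards [ae_tendsto_sum_div_sum_integral hX h01 hindep hdiv] with ω hω
  refine (tendsto_add_atTop_iff_nat v).1
    ((one_mul (1 : ℝ) ▸ hω.mul (tendsto_div_of_tendsto_sub hlog hc)).congr' ?_)
  filter_upwards [hdiv.eventually_ne_atTop 0] with k hk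
  rw [div_mul_div_cancel₀ hk, cast_inDegree_add]

end IsUniformAttachment

end InDegree

section Asymptotics

open Graph
open scoped Finset

variable {α β : Type*} {m : ℕ} {f : ℕ → Fin m → ℕ}

lemma attachmentGraph_mono (f : ℕ → Fin m → ℕ) : Monotone (attachmentGraph f) := fun _ _ h ↦
  ⟨fun _ hx ↦ ⟨hx.1, hx.2.trans h⟩, fun _ _ _ hlink ↦ ⟨hlink.1, hlink.2.1.trans h, hlink.2.2⟩⟩

lemma finite_edgeSet_attachmentGraph (f : ℕ → Fin m → ℕ) (n : ℕ) :
    E(attachmentGraph f n).Finite := by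
  refine ((Set.finite_Iic n).prod Set.finite_univ).subset ?_
  rintro e ⟨x, y, hlink⟩
  exact ⟨by exact_mod_cast hlink.2.1, trivial⟩

lemma eventually_le_attachmentGraph {K : Graph ℕ (ℕ × Fin m)} (hK : K ≤ attachmentGraph f ⊤)
    (hV : V(K).Finite) : ∀ᶠ n : ℕ in atTop, K ≤ attachmentGraph f n := by
  obtain ⟨N, hN⟩ := hV.bddAbove
  filter_upwards [eventually_ge_atTop N] with n hn
  have hle {x : ℕ} (hx : x ∈ V(K)) : (x : ℕ∞) ≤ n := by exact_mod_cast (hN hx).trans hn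
  refine ⟨fun x hx ↦ ⟨(hK.vertexSet_mono hx).1, hle hx⟩, fun e x y hxy ↦ ?_⟩
  have hlink := hxy.mono hK
  refine ⟨hlink.1, hle ?_, hlink.2.2⟩
  rw [(eq_max_and_apply_eq_min_of_isLink hlink).1]
  exact max_rec' (· ∈ V(K)) hxy.left_mem hxy.right_mem

lemma eventually_copies_eq {G : Graph α β} (hV : V(G).Finite)
    (hfin : (copies G (attachmentGraph f ⊤)).Finite) :
    ∀ᶠ n : ℕ in atTop, copies G (attachmentGraph f n) = copies G (attachmentGraph f ⊤) := by
  have hle : ∀ K ∈ copies G (attachmentGraph f ⊤), ∀ᶠ n : ℕ in atTop, K ≤ attachmentGraph f n := by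
    rintro K ⟨hK, φ, -⟩
    have := hV.to_subtype
    exact eventually_le_attachmentGraph hK (Finite.of_equiv _ φ.symm)
  filter_upwards [(eventually_all_finite hfin).2 hle] with n hn
  exact Set.Subset.antisymm (fun K hK ↦ ⟨hK.1.trans (attachmentGraph_mono f le_top), hK.2⟩)
    fun K hK ↦ ⟨hn K hK, hK.2⟩

/-- The edges of the attachment graph with choices `f`, born by time `n`, whose earlier end lies in
`A`. -/
def edgesInto (f : ℕ → Fin m → ℕ) (A : Finset ℕ) (n : ℕ) : Finset (ℕ × Fin m) :=
  {e ∈ Finset.range (n + 1) ×ˢ Finset.univ | f e.1 e.2 ∈ A ∧ f e.1 e.2 < e.1}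

lemma mem_edgesInto {A : Finset ℕ} {n : ℕ} {e : ℕ × Fin m} :
    e ∈ edgesInto f A n ↔ e.1 ≤ n ∧ f e.1 e.2 ∈ A ∧ f e.1 e.2 < e.1 := by
  simp [edgesInto]

lemma card_edgesInto (A : Finset ℕ) (n : ℕ) :
    #(edgesInto f A n) = ∑ p ∈ A ×ˢ Finset.univ, inDegree f p.2 p.1 n := by
  rw [Finset.card_eq_sum_card_fiberwise (t := A ×ˢ Finset.univ) (f := fun e ↦ (f e.1 e.2, e.2))
    fun e he ↦ by simpa using (mem_edgesInto.1 he).2.1]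
  refine Finset.sum_congr rfl ?_
  rintro ⟨v, a⟩ hv
  have mem_fiber (e : ℕ × Fin m) : e ∈ {e ∈ edgesInto f A n | (f e.1 e.2, e.2) = (v, a)} ↔
      e.1 ∈ Finset.Ioc v n ∧ f e.1 a = v ∧ e.2 = a := by
    obtain ⟨j, b⟩ := e
    have hvA := (Finset.mem_product.1 hv).1
    simp only [Finset.mem_filter, mem_edgesInto, Finset.mem_Ioc, Prod.mk.injEq]
    grind
  refine (Finset.card_nbij (fun j ↦ (j, a)) (fun j hj ↦ ?_) (fun i _ j _ h ↦ congrArg Prod.fst h)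
    fun e he ↦ ?_).symm
  · obtain ⟨hj, hf⟩ := Finset.mem_filter.1 hj
    exact (mem_fiber _).2 ⟨hj, hf, rfl⟩
  · obtain ⟨hj, hf, ha⟩ := (mem_fiber e).1 he
    exact ⟨e.1, Finset.mem_filter.2 ⟨hj, hf⟩, Prod.ext rfl ha.symm⟩

lemma tendsto_card_edgesInto_div_log
    (hlog : ∀ v, 0 < v → ∀ a, Tendsto (fun n ↦ (inDegree f a v n : ℝ) / Real.log n) atTop (𝓝 1))
    {A : Finset ℕ} (hA : ∀ v ∈ A, 0 < v) :
    Tendsto (fun n ↦ (#(edgesInto f A n) : ℝ) / Real.log n) atTop (𝓝 (#A * m : ℕ)) := by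
  have hsum := tendsto_finsetSum (A ×ˢ (Finset.univ : Finset (Fin m)))
    fun p hp ↦ hlog p.1 (hA p.1 (Finset.mem_product.1 hp).1) p.2
  simpa [card_edgesInto, Finset.sum_div] using hsum

lemma tendsto_div_of_abs_sub_le {ι : Type*} {l : Filter ι} {u u' w : ι → ℝ} {C c : ℝ}
    (hw : Tendsto w l atTop) (hC : ∀ i, |u' i - u i| ≤ C)
    (h : Tendsto (fun i ↦ u i / w i) l (𝓝 c)) : Tendsto (fun i ↦ u' i / w i) l (𝓝 c) := by
  have hdiff : Tendsto (fun i ↦ u' i / w i - u i / w i) l (𝓝 0) := by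
    refine squeeze_zero_norm' ?_ (hw.const_div_atTop C)
    filter_upwards [hw.eventually_gt_atTop 0] with i hi
    rw [← sub_div, norm_div, Real.norm_eq_abs, Real.norm_of_nonneg hi.le]
    exact div_le_div_of_nonneg_right (hC i) hi.le
  simpa using hdiff.add h

lemma abs_ncard_sub_ncard_le {s t F : Set α} (hs : s.Finite) (ht : t.Finite) (hF : F.Finite)
    (h : ∀ x ∉ F, x ∈ s ↔ x ∈ t) : |(s.ncard : ℝ) - t.ncard| ≤ F.ncard := by
  have ncard_le {s t : Set α} (ht : t.Finite) (h : ∀ x ∉ F, x ∈ s → x ∈ t) :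
      (s.ncard : ℝ) ≤ t.ncard + F.ncard := by
    have hst : s ⊆ t ∪ F := fun x hx ↦ or_iff_not_imp_right.2 fun hxF ↦ h x hxF hx
    exact_mod_cast (Set.ncard_le_ncard hst (ht.union hF)).trans (Set.ncard_union_le t F)
  rw [abs_sub_le_iff, sub_le_iff_le_add', sub_le_iff_le_add']
  exact ⟨ncard_le ht fun x hx ↦ (h x hx).1, ncard_le hs fun x hx ↦ (h x hx).2⟩

lemma mem_extendingEdges_attachmentGraph_iff {H : Graph α β} {K : Graph ℕ (ℕ × Fin m)}
    (hK : K ≤ attachmentGraph f ⊤) {A : Finset ℕ}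
    (hA : ∀ v, v ∈ A ↔ ∃ hv : v ∈ V(K), IsIso (K.attachEdge ⟨v, hv⟩) H) {n : ℕ} {e : ℕ × Fin m}
    (he : e.1 ∉ V(K)) :
    e ∈ extendingEdges H K (attachmentGraph f n) ↔ e ∈ edgesInto f A n := by
  rw [mem_edgesInto]
  constructor
  · rintro ⟨v, hv, w, -, ⟨-, hn, ⟨-, hlt⟩, hends⟩, hiso⟩
    rcases Sym2.eq_iff.1 hends with ⟨rfl, -⟩ | ⟨rfl, -⟩
    · exact absurd hv he
    · exact ⟨by exact_mod_cast hn, (hA _).2 ⟨hv, hiso⟩, hlt⟩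
  · rintro ⟨hn, hmem, hlt⟩
    obtain ⟨hv, hiso⟩ := (hA _).1 hmem
    have hpos := (hK.vertexSet_mono hv).1
    exact ⟨_, hv, e.1, he, ⟨(Nat.succ_le_succ hpos).trans hlt, by exact_mod_cast hn, ⟨hpos, hlt⟩,
      Sym2.eq_swap⟩, hiso⟩

lemma tendsto_ncard_extendingEdges_div_log
    (hlog : ∀ v, 0 < v → ∀ a, Tendsto (fun n ↦ (inDegree f a v n : ℝ) / Real.log n) atTop (𝓝 1))
    (H : Graph α β) {K : Graph ℕ (ℕ × Fin m)} (hK : K ≤ attachmentGraph f ⊤) (hV : V(K).Finite) :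
    Tendsto (fun n : ℕ ↦ ((extendingEdges H K (attachmentGraph f n)).ncard : ℝ) / Real.log n)
      atTop (𝓝 (attachCount K H * m : ℕ)) := by
  have := hV.to_subtype
  have hfin : {v : V(K) | IsIso (K.attachEdge v) H}.Finite := Set.toFinite _
  let A : Finset ℕ := hfin.toFinset.map (.subtype _)
  have mem_A (v : ℕ) : v ∈ A ↔ ∃ hv : v ∈ V(K), IsIso (K.attachEdge ⟨v, hv⟩) H := by
    simp [A]
  have card_A : #A = attachCount K H := by
    rw [Finset.card_map, attachCount, Set.ncard_eq_toFinset_card _ hfin]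
  have hpos (v : ℕ) (hv : v ∈ A) : 0 < v := (hK.vertexSet_mono ((mem_A v).1 hv).1).1
  refine tendsto_div_of_abs_sub_le (C := (V(K) ×ˢ (Set.univ : Set (Fin m))).ncard)
    tendsto_log_natCast (fun n ↦ ?_) (card_A ▸ tendsto_card_edgesInto_div_log hlog hpos)
  rw [← Set.ncard_coe_finset]
  refine abs_ncard_sub_ncard_le ?_ (Finset.finite_toSet _) (hV.prod Set.finite_univ) fun e he ↦ ?_
  · exact (finite_edgeSet_attachmentGraph f n).subset fun e ⟨_, _, _, _, h, _⟩ ↦ h.edge_mem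
  · exact mem_extendingEdges_attachmentGraph_iff hK mem_A fun h ↦ he ⟨h, trivial⟩

lemma tendsto_ncard_copies_div_log {H' H : Graph α β} {e₀ : β} {v₀ w₀ : α}
    (h : IsPendantExtension H' H e₀ v₀ w₀) (hdeg : ∀ x ∈ V(H'), 2 ≤ H'.deg x) (hV : V(H').Finite)
    (hfin : (copies H' (attachmentGraph f ⊤)).Finite)
    (hlog : ∀ v, 0 < v → ∀ a, Tendsto (fun n ↦ (inDegree f a v n : ℝ) / Real.log n) atTop (𝓝 1)) :
    Tendsto (fun n : ℕ ↦ ((copies H (attachmentGraph f n)).ncard : ℝ) / Real.log n) atTop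
      (𝓝 ((attachCount H' H * m : ℕ) * ((copies H' (attachmentGraph f ⊤)).ncard : ℝ))) := by
  have hsum : Tendsto (fun n : ℕ ↦ ∑ K ∈ hfin.toFinset,
      ((extendingEdges H K (attachmentGraph f n)).ncard : ℝ) / Real.log n) atTop
      (𝓝 (∑ _K ∈ hfin.toFinset, ((attachCount H' H * m : ℕ) : ℝ))) := by
    refine tendsto_finsetSum _ fun K hK ↦ ?_
    obtain ⟨hle, hiso⟩ := hfin.mem_toFinset.1 hK
    obtain ⟨φ, -⟩ := id hiso
    have := hV.to_subtype
    rw [← attachCount_congr hiso]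
    exact tendsto_ncard_extendingEdges_div_log hlog H hle (Finite.of_equiv _ φ.symm)
  rw [Finset.sum_const, nsmul_eq_mul, ← Set.ncard_eq_toFinset_card _ hfin, mul_comm] at hsum
  refine hsum.congr' ?_
  filter_upwards [eventually_copies_eq hV hfin] with n hn
  rw [ncard_copies_eq_sum h hdeg (finite_edgeSet_attachmentGraph f n) (hn ▸ hfin), Nat.cast_sum,
    Finset.sum_div]
  exact Finset.sum_congr (by simp [hn]) fun _ _ ↦ rfl

end Asymptotics

theorem theorem3p8 {α β Ω : Type*} [MeasurableSpace Ω] (μ : Measure Ω) [IsProbabilityMeasure μ]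
    (m : ℕ) (hm : 1 ≤ m) (U : ℕ → Fin m → Ω → ℕ) (hU : IsUniformAttachment U μ)
    (H H' : Graph α β) (hloop : H.Loopless) (hV : V(H).Finite) (hE : E(H).Finite)
    (hconn : H.IsConnected) (hmulti : H.IsMulticyclic) (hcore : Graph.IsTwoCore H' H)
    (ht : (V(H) \ V(H')).ncard = 1) :
    0 < Graph.attachCount H' H * m ∧
    ∀ᵐ ω ∂μ,
      (Graph.copies H' (attachmentGraph (fun j a ↦ U j a ω) ⊤)).Finite ∧
      Tendsto (fun n : ℕ ↦ (copyCount H U n ω : ℝ) / Real.log n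
        - (Graph.attachCount H' H * m : ℕ) * (copyCount H' U n ω : ℝ)) atTop (𝓝 0) ∧
      Tendsto (fun n : ℕ ↦ (copyCount H U n ω : ℝ) / Real.log n) atTop
        (𝓝 ((Graph.attachCount H' H * m : ℕ) * (copyCount H' U ⊤ ω : ℝ))) := by
  obtain ⟨e, v, w, hext⟩ := exists_isPendantExtension hconn hmulti hcore ht
  obtain ⟨hle, hdeg⟩ := hcore.1
  have := hloop.anti hle
  have hV' : V(H').Finite := hV.subset hle.vertexSet_mono
  have hfinite := hU.ae_finite_copies hV' (hE.subset hle.edgeSet_mono) (hext.isConnected hconn)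
    hdeg (isMulticyclic_of_isTwoCore hcore hmulti)
  have hlog : ∀ᵐ ω ∂μ, ∀ v, 0 < v → ∀ a,
      Tendsto (fun n ↦ (inDegree (fun j b ↦ U j b ω) a v n : ℝ) / Real.log n) atTop (𝓝 1) := by
    simp only [ae_all_iff]
    exact fun v hv a ↦ hU.ae_tendsto_inDegree_div_log hv a
  refine ⟨Nat.mul_pos (hext.attachCount_pos hV') hm, ?_⟩
  filter_upwards [hfinite, hlog] with ω hfin hω
  have hlim := tendsto_ncard_copies_div_log hext hdeg hV' hfin hω
  refine ⟨hfin, ?_, hlim⟩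
  rw [← sub_self (_ : ℝ)]
  refine hlim.sub (tendsto_const_nhds.congr' ?_)
  filter_upwards [eventually_copies_eq hV' hfin] with n hn
  rw [copyCount, hn]
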